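/- **Setting.** Let $d\ge 1$, $\beta>0$, $M\in\mathbb R$, $\alpha\in(0,1)$, and let $\mathcal V$ be a measurable space. Let $n_1=n_2=n$ and $m_1=m_1(n)$, $m_2=m_2(n)$ be even (the $m_i$ are otherwise arbitrary). For laws $P_{XV},P_{YW}$ on $\mathbb R^d\times\mathcal V$ with marginals $P_X,P_V,P_Y,P_W$, one observes mutually independent samples: labeled data $(X_i,V_i)_{i\le n}$ i.i.d. from $P_{XV}$ and $(Y_i,W_i)_{i\le n}$ i.i.d. from $P_{YW}$; unlabeled data $(V_i)_{n<i\le n+m_1}$ i.i.d. from $P_V$ and $(W_i)_{n<i\le n+m_2}$ i.i.d. from $P_W$; and $\widetilde X_1,\dots,\widetilde X_n$ i.i.d. from $P_X$, $\widetilde Y_1,\dots,\widetilde Y_n$ i.i.d. from $P_Y$. **Test.** Let $k_{s}(x,y)=\exp(-s\|x-y\|^2)$ and $\widehat f(\cdot)=\frac1n\sum_{i}k_{s_n}(\widetilde X_i,\cdot)-\frac1n\sum_i k_{s_n}(\widetilde Y_i,\cdot)$. Regression procedures (measurable, possibly depending on $n$) map $\widehat f$ and $n/2$ labeled points to functions $\widehat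 u_X,\widehat u_Y:\mathcal V\to\mathbb R$, which estimate $v\mapsto\mathbb E[\widehat f(X)\mid V=v,\widehat f]$ and $w\mapsto\mathbb E[\widehat f(Y)\mid W=w,\widehat f]$. For $i\le n+m_1$ let $\widehat e_i$ be the value at $V_i$ of $\widehat u_X$ trained on the labeled points $(X_j,V_j)$ whose index $j\le n$ has parity opposite to that of $i$, and put $r_i=\widehat f(X_i)-\widehat e_i$ for $i\le n$. Put $$\widehat\mu_X^\dagger=\frac1n\sum_{i\le n}r_i+\frac1{n+m_1}\sum_{i\le n+m_1}\widehat e_i,\qquad \widehat\sigma_X^{\dagger2}=\frac{\widehat\sigma_{1,X}^{\dagger2}}{n}+\frac{\widehat\sigma_{2,X}^{\dagger2}}{n+m_1},$$ where $\widehat\sigma_{1,X}^{\dagger2}=\frac1n\sum_{i\le n} r_i^2-(\frac1n\sum_{i\le n} r_i)^2$ and $\widehat\sigma_{2,X}^{\dagger2}=\frac1{n+m_1}\sum_{i\le n+m_1}\widehat e_i^{\,2}-(\frac1{n+m_1}\sum_{i\le n+m_1}\widehat e_i)^2$. Define $\widehat\mu_Y^\dagger,\widehat\sigma_Y^{\dagger2}$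 in the same way from $(Y_i,W_i)$, $\widehat u_Y$ and $m_2$. The xssMMD test is $\Psi_{\mathrm{xss}}=\mathbf 1\{(\widehat\mu_X^\dagger-\widehat\mu_Y^\dagger)/\sqrt{\widehat\sigma_X^{\dagger2}+\widehat\sigma_Y^{\dagger2}}>z_{1-\alpha}\}$, where $z_{1-\alpha}$ is the $(1-\alpha)$-quantile of $N(0,1)$; if the denominator is $0$, the test rejects exactly when the numerator is positive. **Alternatives.** Let $\mathcal W^{\beta,2}(M)$ be the set of integrable, almost everywhere continuous $f:\mathbb R^d\to\mathbb R$ with $\int(1+\|\omega\|^2)^{\beta}|\mathcal F(f)(\omega)|^2\,d\omega<M$, where $\mathcal F(f)(\omega)=\int e^{-2\pi i\langle x,\omega\rangle}f(x)\,dx$. Let $\mathcal P_n^{(1)}$ be the set of pairs $(P_X,P_Y)$ of probability laws on $\mathbb R^d$ with Lebesgue densities $p_X,p_Y\in\mathcal W^{\beta,2}(M)$ and $\|p_X-p_Y\|_{L^2}\ge\Delta_n$. For every even $n$ let $\mathcal Q_n$ be a set of pairs $(P_{XV},P_{YW})$ whose marginals $(P_X,P_Y)$ lie in $\mathcal P^{(1)}_n$.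 **Corollary.** Let $s_n>0$, $s_n\asymp n^{4/(d+4\beta)}$ and $\lim_{n\to\infty}\Delta_n n^{2\beta/(d+4\beta)}=\infty$. Suppose that the residual condition holds: there is a constant $C$ such that for all even $n\ge2$ and all $(P_{XV},P_{YW})\in\mathcal Q_n$, $$\mathbb E\bigl[\{\widehat f(X)-\widehat u_X(V)\}^2\bigr]\le C\,\mathbb E\bigl[\mathrm{Var}\{\widehat f(X)\mid\widehat f\}\bigr],\qquad \mathbb E\bigl[\{\widehat f(Y)-\widehat u_Y(W)\}^2\bigr]\le C\,\mathbb E\bigl[\mathrm{Var}\{\widehat f(Y)\mid\widehat f\}\bigr],$$ where $(X,V)\sim P_{XV}$ and $(Y,W)\sim P_{YW}$ are independent of $\widehat f$ and of the $n/2$ i.i.d. labeled points on which $\widehat u_X$, respectively $\widehat u_Y$, is trained. Then, along even $n$, $$\lim_{n\to\infty}\ \inf_{(P_{XV},P_{YW})\in\mathcal Q_n}\mathbb E[\Psi_{\mathrm{xss}}]=1,$$ where the infimum is taken in $[0,1]$ (it is $1$ if $\mathcal Q_n$ is empty). -/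

import Mathlib

open MeasureTheory ProbabilityTheory Filter Asymptotics
open scoped Topology ENNReal NNReal FourierTransform

namespace XssMMD

/-- The sample space of the primary variables. -/
abbrev Rd (d : ℕ) : Type := EuclideanSpace ℝ (Fin d)

/-! ### Kernel and witness function -/

/-- The Gaussian kernel `k_s(x, y) = exp(-s ‖x - y‖²)`. -/
noncomputable def gaussianKernel {d : ℕ} (s : ℝ) (x y : Rd d) : ℝ :=
  Real.exp (-s * ‖x - y‖ ^ 2)

/-- The estimated witness function
`f̂(x) = n₁⁻¹ ∑ᵢ k(X̃ᵢ, x) - n₂⁻¹ ∑ᵢ k(Ỹᵢ, x)`. -/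
noncomputable def witness {d n₁ n₂ : ℕ} (k : Rd d → Rd d → ℝ)
    (xt : Fin n₁ → Rd d) (yt : Fin n₂ → Rd d) (x : Rd d) : ℝ :=
  (1 / (n₁ : ℝ)) * ∑ i, k (xt i) x - (1 / (n₂ : ℝ)) * ∑ i, k (yt i) x

/-! ### Cross-fitted mean and variance of one (labelled + unlabelled) sample

A labelled sample of even size `n = 2 N` is indexed by `Bool × Fin N`: the first coordinate
tells the fold (`false` for the odd positions, `true` for the even positions of the sample), the
second the place inside the fold. An unlabelled sample of even size `m = 2 h` is indexed by
`Bool × Fin h` in the same way.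

In this section `f` is the function that is averaged and `u S : 𝒱 → ℝ` is the estimate of
`v ↦ E[f(X) | V = v]` that is trained on the `N` labelled points `S`. -/

section CrossFit

variable {d N h : ℕ} {𝒱 : Type*}

/-- The fitted regression used at indices of fold `j`: it is trained on the other fold. -/
def crossFit (u : (Fin N → Rd d × 𝒱) → 𝒱 → ℝ) (L : Bool × Fin N → Rd d × 𝒱) (j : Bool) :
    𝒱 → ℝ :=
  u (fun i => L (!j, i))

/-- `Ê[f(Xᵢ) | Vᵢ]` at a labelled index. -/
def fitLabelled (u : (Fin N → Rd d × 𝒱) → 𝒱 → ℝ) (L : Bool × Fin N → Rd d × 𝒱)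
    (i : Bool × Fin N) : ℝ :=
  crossFit u L i.1 (L i).2

/-- `Ê[f(Xᵢ) | Vᵢ]` at an unlabelled index. -/
def fitUnlabelled (u : (Fin N → Rd d × 𝒱) → 𝒱 → ℝ) (L : Bool × Fin N → Rd d × 𝒱)
    (U : Bool × Fin h → 𝒱) (i : Bool × Fin h) : ℝ :=
  crossFit u L i.1 (U i)

/-- The residual `f(Xᵢ) - Ê[f(Xᵢ) | Vᵢ]` at a labelled index. -/
noncomputable def resid (f : Rd d → ℝ) (u : (Fin N → Rd d × 𝒱) → 𝒱 → ℝ)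
    (L : Bool × Fin N → Rd d × 𝒱) (i : Bool × Fin N) : ℝ :=
  f (L i).1 - fitLabelled u L i

/-- The cross-fitted semi-supervised mean estimator `μ̂†`, with `n = 2 N`, `m = 2 h`. -/
noncomputable def muHat (f : Rd d → ℝ) (u : (Fin N → Rd d × 𝒱) → 𝒱 → ℝ)
    (L : Bool × Fin N → Rd d × 𝒱) (U : Bool × Fin h → 𝒱) : ℝ :=
  (1 / (2 * N : ℝ)) * ∑ i, resid f u L i
    + (1 / (2 * N + 2 * h : ℝ)) * (∑ i, fitLabelled u L i + ∑ i, fitUnlabelled u L U i)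

/-- The empirical variance `σ̂₁†²` of the `n` residuals. -/
noncomputable def sigmaSqOne (f : Rd d → ℝ) (u : (Fin N → Rd d × 𝒱) → 𝒱 → ℝ)
    (L : Bool × Fin N → Rd d × 𝒱) : ℝ :=
  (1 / (2 * N : ℝ)) * ∑ i, resid f u L i ^ 2 - ((1 / (2 * N : ℝ)) * ∑ i, resid f u L i) ^ 2

/-- The empirical variance `σ̂₂†²` of the `n + m` fitted values. -/
noncomputable def sigmaSqTwo (u : (Fin N → Rd d × 𝒱) → 𝒱 → ℝ)
    (L : Bool × Fin N → Rd d × 𝒱) (U : Bool × Fin h → 𝒱) : ℝ :=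
  (1 / (2 * N + 2 * h : ℝ)) *
      (∑ i, fitLabelled u L i ^ 2 + ∑ i, fitUnlabelled u L U i ^ 2)
    - ((1 / (2 * N + 2 * h : ℝ)) *
      (∑ i, fitLabelled u L i + ∑ i, fitUnlabelled u L U i)) ^ 2

/-- The cross-fitted variance estimator `σ̂†² = n⁻¹ σ̂₁†² + (n + m)⁻¹ σ̂₂†²`. -/
noncomputable def sigmaSq (f : Rd d → ℝ) (u : (Fin N → Rd d × 𝒱) → 𝒱 → ℝ)
    (L : Bool × Fin N → Rd d × 𝒱) (U : Bool × Fin h → 𝒱) : ℝ :=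
  (1 / (2 * N : ℝ)) * sigmaSqOne f u L + (1 / (2 * N + 2 * h : ℝ)) * sigmaSqTwo u L U

end CrossFit

/-! ### The test -/

/-- The studentized ratio `a / √v`, read as `+∞` (for `a > 0`) or `-∞` (for `a ≤ 0`) when the
variance estimate `v` vanishes. -/
noncomputable def studentize (a v : ℝ) : EReal :=
  if 0 < v then ((a / √v : ℝ) : EReal) else if 0 < a then ⊤ else ⊥

/-- The `q`-quantile of the standard normal distribution. -/
noncomputable def normalQuantile (q : ℝ) : ℝ :=
  sInf {x : ℝ | q ≤ cdf (gaussianReal 0 1) x}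

/-- A conditional mean estimator: from a function `f`, `N` labelled points and a covariate value
it computes an estimate of the conditional mean of `f` of the primary variable. -/
abbrev Regressor (d N : ℕ) (𝒱 : Type*) : Type _ :=
  (Rd d → ℝ) → (Fin N → Rd d × 𝒱) → 𝒱 → ℝ

/-- All the data, for `n₁ = n₂ = 2 N`, `m₁ = 2 h₁`, `m₂ = 2 h₂`: the points `X̃` and `Ỹ` on which
the witness function is built, the labelled and unlabelled first sample, and the labelled and
unlabelled second sample. -/
abbrev Data (d N h₁ h₂ : ℕ) (𝒱 : Type*) : Type _ :=
  ((Fin (2 * N) → Rd d) × (Fin (2 * N) → Rd d)) ×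
    ((Bool × Fin N → Rd d × 𝒱) × (Bool × Fin h₁ → 𝒱)) ×
    ((Bool × Fin N → Rd d × 𝒱) × (Bool × Fin h₂ → 𝒱))

/-- The law of `(X̃, Ỹ)`: independent i.i.d. samples of size `2 N` from the `X`-marginal of `PXV`
and from the `Y`-marginal of `PYW`. -/
noncomputable def witnessLaw {d : ℕ} {𝒱 : Type*} [MeasurableSpace 𝒱] (N : ℕ)
    (PXV PYW : Measure (Rd d × 𝒱)) : Measure ((Fin (2 * N) → Rd d) × (Fin (2 * N) → Rd d)) :=
  (Measure.pi fun _ => PXV.fst).prod (Measure.pi fun _ => PYW.fst)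

/-- The joint law of all the data: all points are independent, labelled points follow `PXV` or
`PYW`, and unlabelled points the marginal law of `V` or `W`. -/
noncomputable def dataLaw {d : ℕ} {𝒱 : Type*} [MeasurableSpace 𝒱] (N h₁ h₂ : ℕ)
    (PXV PYW : Measure (Rd d × 𝒱)) : Measure (Data d N h₁ h₂ 𝒱) :=
  (witnessLaw N PXV PYW).prod
    (((Measure.pi fun _ => PXV).prod (Measure.pi fun _ => PXV.snd)).prod
      ((Measure.pi fun _ => PYW).prod (Measure.pi fun _ => PYW.snd)))

section Test

variable {d N h₁ h₂ : ℕ} {𝒱 : Type*}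

/-- The xssMMD statistic
`(μ̂†_{X,f̂} - μ̂†_{Y,f̂}) / √(σ̂†²_{X,f̂} + σ̂†²_{Y,f̂})` with kernel `k`. -/
noncomputable def xssStatistic (k : Rd d → Rd d → ℝ) (uX uY : Regressor d N 𝒱)
    (D : Data d N h₁ h₂ 𝒱) : EReal :=
  let f := witness k D.1.1 D.1.2
  studentize (muHat f (uX f) D.2.1.1 D.2.1.2 - muHat f (uY f) D.2.2.1 D.2.2.2)
    (sigmaSq f (uX f) D.2.1.1 D.2.1.2 + sigmaSq f (uY f) D.2.2.1 D.2.2.2)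

/-- The expectation `E[Ψ_xss]` of the test `Ψ_xss = 1(statistic > z_{1-α})`. -/
noncomputable def xssPower [MeasurableSpace 𝒱] (h₁ h₂ : ℕ) (α : ℝ) (k : Rd d → Rd d → ℝ)
    (uX uY : Regressor d N 𝒱) (PXV PYW : Measure (Rd d × 𝒱)) : ℝ :=
  (dataLaw N h₁ h₂ PXV PYW).real
    {D | (normalQuantile (1 - α) : EReal) < xssStatistic k uX uY D}

/-- The infimum of the power over a class `𝒬` of pairs of joint laws, taken in `[0, 1]` (so that
it is `1` for the empty class). -/
noncomputable def worstCasePower [MeasurableSpace 𝒱] (h₁ h₂ : ℕ) (α : ℝ)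
    (k : Rd d → Rd d → ℝ) (uX uY : Regressor d N 𝒱)
    (𝒬 : Set (ProbabilityMeasure (Rd d × 𝒱) × ProbabilityMeasure (Rd d × 𝒱))) : ℝ :=
  sInf (insert 1 ((fun q => xssPower h₁ h₂ α k uX uY (q.1 : Measure (Rd d × 𝒱)) q.2) '' 𝒬))

/-! ### The residual condition -/

/-- Joint measurability of the fitted values in `X̃`, `Ỹ`, the training points and the covariate,
for the witness function of kernel `k`. -/
def MeasurableRegressor [MeasurableSpace 𝒱] (k : Rd d → Rd d → ℝ) (u : Regressor d N 𝒱) : Prop :=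
  Measurable fun z : ((Fin (2 * N) → Rd d) × (Fin (2 * N) → Rd d)) ×
      (Fin N → Rd d × 𝒱) × 𝒱 =>
    u (witness k z.1.1 z.1.2) z.2.1 z.2.2

/-- `E[{f̂(Z) - û(T)}²]`, where `w = (X̃, Ỹ)` has law `ν`, `û` is trained on `N` i.i.d. points from
`ρ`, and `(Z, T)` is a fresh point from `ρ`. -/
noncomputable def residualSecondMoment [MeasurableSpace 𝒱] (k : Rd d → Rd d → ℝ)
    (u : Regressor d N 𝒱) (ν : Measure ((Fin (2 * N) → Rd d) × (Fin (2 * N) → Rd d)))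
    (ρ : Measure (Rd d × 𝒱)) : ℝ≥0∞ :=
  ∫⁻ w, (∫⁻ S, (∫⁻ z,
      ENNReal.ofReal ((witness k w.1 w.2 z.1 - u (witness k w.1 w.2) S z.2) ^ 2) ∂ρ)
    ∂(Measure.pi fun _ : Fin N => ρ)) ∂ν

/-- `E[Var{f̂(Z) | f̂}]`, where `w = (X̃, Ỹ)` has law `ν` and `Z` is an independent point with the
first marginal of `ρ` as its law. -/
noncomputable def expectedCondVariance [MeasurableSpace 𝒱] (k : Rd d → Rd d → ℝ)
    (ν : Measure ((Fin (2 * N) → Rd d) × (Fin (2 * N) → Rd d)))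
    (ρ : Measure (Rd d × 𝒱)) : ℝ≥0∞ :=
  ∫⁻ w, evariance (witness k w.1 w.2) ρ.fst ∂ν

/-- The residual condition with constant `C`, for both samples:
`E[{f̂(X) - û_X(V)}²] ≤ C E[Var{f̂(X) | f̂}]` and `E[{f̂(Y) - û_Y(W)}²] ≤ C E[Var{f̂(Y) | f̂}]`. -/
def ResidualCondition [MeasurableSpace 𝒱] (k : Rd d → Rd d → ℝ) (uX uY : Regressor d N 𝒱)
    (C : ℝ≥0) (PXV PYW : Measure (Rd d × 𝒱)) : Prop :=
  residualSecondMoment k uX (witnessLaw N PXV PYW) PXV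
      ≤ C * expectedCondVariance k (witnessLaw N PXV PYW) PXV ∧
    residualSecondMoment k uY (witnessLaw N PXV PYW) PYW
      ≤ C * expectedCondVariance k (witnessLaw N PXV PYW) PYW

end Test

/-! ### Smooth local alternatives -/

/-- The Sobolev ball `W^{β,2}(M)` among integrable functions on `ℝᵈ`: almost everywhere continuous
`f` with `∫ (1 + ‖ω‖²)^β |𝓕 f(ω)|² dω < M`. -/
def sobolevBall (d : ℕ) (β M : ℝ) : Set (Rd d → ℝ) :=
  {f | Integrable f volume ∧ (∀ᵐ x ∂(volume : Measure (Rd d)), ContinuousAt f x) ∧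
    ∫⁻ ω : Rd d, ENNReal.ofReal
      ((1 + ‖ω‖ ^ 2) ^ β * ‖𝓕 (fun x : Rd d => (f x : ℂ)) ω‖ ^ 2) < ENNReal.ofReal M}

/-- Pairs of laws on `ℝᵈ` with Lebesgue densities in `W^{β,2}(M)` at `L²`-distance at least `δ`. -/
def smoothAlternatives (d : ℕ) (β M δ : ℝ) : Set (Measure (Rd d) × Measure (Rd d)) :=
  {P | ∃ p ∈ sobolevBall d β M, ∃ q ∈ sobolevBall d β M,
    (∀ x, 0 ≤ p x) ∧ (∀ x, 0 ≤ q x) ∧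
    P.1 = volume.withDensity (fun x => ENNReal.ofReal (p x)) ∧
    P.2 = volume.withDensity (fun x => ENNReal.ofReal (q x)) ∧
    ENNReal.ofReal δ ≤ eLpNorm (p - q) 2 volume}

end XssMMD

set_option linter.unusedSectionVars false

namespace XssMMD

/-! ### Second moments of centred i.i.d. sums -/

section SampleMeans

variable {Ω ι : Type*} [MeasurableSpace Ω] [Fintype ι]

/-! Everything is Chebyshev's inequality, with a signal and a noise computed for the Gaussian
kernel. Let `γ` be the squared maximum mean discrepancy of the two marginals, `c = (π/s)^{d/2}` the
mass of the kernel, and `D` the `L²`-distance of the densities.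

Noise, conditionally on the witness `f̂`. Each fold is evaluated with a regression function trained
on the other one, so that function can be frozen. The centring of residuals and fitted values then
cancels exactly: the cross-fitted mean is unbiased for the mean of `f̂`, however poor the regression
is. Its mean squared error and the mean of the variance estimator are both `O((R + V)/n)`, where `R`
is the residual risk and `V` the variance of `f̂`. The unlabelled sample size drops out, because `n
+ m` terms of weight `(n + m)⁻²` contribute at most `1/n`. The residual condition replaces `R` by `C
V` after averaging over `f̂` (`lintegral_muHat_sub_sq_le`, `lintegral_sigmaSq_le`).

Noise from `f̂` itself. The difference of the conditional means of `f̂` is a difference of sample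
means of the population witness, centred at `γ`. Its variance, and the mean of `V`, are bounded
through `A`, a bound for the second moment of the population witness, and `B`, one for that of the
kernel. A supremum bound and Schur's test give `A = c^{3/2} √M D²` and `B = c M`
(`lintegral_meanWitness_sq_le`, `lintegral_gaussianKernel_sq_le`).

Signal. In Fourier variables `γ` is `c` times the integral of `exp(-π²‖ω‖²/s) |𝓕(p - q)|²`.
Frequencies with `‖ω‖² ≤ s` keep at least the fraction `exp(-π²)`, and the others carry at most `4 M
s^{-β}`, which is negligible against `Δ²`. Hence `γ ≥ c κ D²` with `κ = exp(-π²)/2` (`le_mmdSq`).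

The error probability is thus at most a constant times `τ + τ²` with `τ = √M/(N √c Δ²)`. Since `√c`
is of order `s^{-d/4}`, the choice of `s` makes `N √c Δ²` of the order of the square of `Δ
n^{2β/(d+4β)}`, which tends to infinity. All constants are uniform over the class. -/

lemma evariance_le_lintegral_sq_sub {ν : Measure Ω} [IsProbabilityMeasure ν] {g : Ω → ℝ}
    (hg : MemLp g 2 ν) (c : ℝ) :
    evariance g ν ≤ ∫⁻ y, ENNReal.ofReal ((g y - c) ^ 2) ∂ν := by
  have hgc : MemLp (fun y => g y - c) 2 ν := hg.sub (memLp_const c)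
  rw [← ofReal_variance hg, ← variance_sub_const hg.aestronglyMeasurable c,
    ← ofReal_integral_eq_lintegral_ofReal hgc.integrable_sq (ae_of_all _ fun _ => sq_nonneg _)]
  exact ENNReal.ofReal_le_ofReal (variance_le_expectation_sq hgc.aestronglyMeasurable)

/-- The second moment of a centred sum of i.i.d. variables. -/
lemma lintegral_sq_sum_sub_le {ν : Measure Ω} [IsProbabilityMeasure ν] {g : Ω → ℝ}
    (hg : MemLp g 2 ν) (c : ℝ) :
    ∫⁻ x, ENNReal.ofReal ((∑ i : ι, (g (x i) - ∫ y, g y ∂ν)) ^ 2) ∂(Measure.pi fun _ => ν)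
      ≤ Fintype.card ι * ∫⁻ y, ENNReal.ofReal ((g y - c) ^ 2) ∂ν := by
  have hcomp : ∀ i : ι, MemLp (fun x : ι → Ω => g (x i)) 2 (Measure.pi fun _ => ν) := fun i =>
    hg.comp_measurePreserving (measurePreserving_eval (fun _ => ν) i)
  have hmean : ∀ i : ι, ∫ x : ι → Ω, g (x i) ∂(Measure.pi fun _ => ν) = ∫ y, g y ∂ν := fun i => by
    have h := measurePreserving_eval (fun _ : ι => ν) i
    have h' := integral_map h.measurable.aemeasurable
      (h.map_eq.symm ▸ hg.aestronglyMeasurable : AEStronglyMeasurable g _)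
    rw [h.map_eq] at h'
    exact h'.symm
  have hsum : MemLp (∑ i : ι, fun x : ι → Ω => g (x i)) 2 (Measure.pi fun _ => ν) :=
    memLp_finsetSum' _ fun i _ => hcomp i
  have hEsum : ∫ x, (∑ i : ι, fun x : ι → Ω => g (x i)) x ∂(Measure.pi fun _ => ν)
      = ∑ _i : ι, ∫ y, g y ∂ν := by
    simp only [Finset.sum_apply]
    rw [integral_finsetSum _ fun i _ => (hcomp i).integrable one_le_two]
    exact Finset.sum_congr rfl fun i _ => hmean i
  have h1 : ∫⁻ x, ENNReal.ofReal ((∑ i : ι, (g (x i) - ∫ y, g y ∂ν)) ^ 2)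
      ∂(Measure.pi fun _ => ν)
      = evariance (∑ i : ι, fun x : ι → Ω => g (x i)) (Measure.pi fun _ => ν) := by
    rw [evariance_eq_lintegral_ofReal, hEsum]
    simp only [Finset.sum_apply, Finset.sum_sub_distrib]
  -- Variances add over the independent coordinates. The centre `c` stays free because the variance
  -- is the smallest second moment.
  rw [h1, ← ofReal_variance hsum, variance_sum_pi fun _ => hg]
  calc ENNReal.ofReal (∑ _i : ι, variance g ν) = Fintype.card ι * evariance g ν := by
        rw [Finset.sum_const, nsmul_eq_mul, ENNReal.ofReal_mul (by positivity),
          ofReal_variance hg]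
        simp
    _ ≤ _ := by gcongr; exact evariance_le_lintegral_sq_sub hg c

lemma lintegral_ofReal_mul_sq (μ : Measure Ω) (a : ℝ) (F : Ω → ℝ) :
    ∫⁻ x, ENNReal.ofReal ((a * F x) ^ 2) ∂μ
      = ENNReal.ofReal (a ^ 2) * ∫⁻ x, ENNReal.ofReal (F x ^ 2) ∂μ := by
  rw [← lintegral_const_mul' _ _ ENNReal.ofReal_ne_top]
  simp only [mul_pow, ENNReal.ofReal_mul (sq_nonneg a)]

lemma ofReal_sq_add_le (a b : ℝ) :
    ENNReal.ofReal ((a + b) ^ 2) ≤ 2 * ENNReal.ofReal (a ^ 2) + 2 * ENNReal.ofReal (b ^ 2) := by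
  have h2 : (2 : ℝ≥0∞) = ENNReal.ofReal 2 := by simp
  rw [h2, ← ENNReal.ofReal_mul zero_le_two, ← ENNReal.ofReal_mul zero_le_two,
    ← ENNReal.ofReal_add (by positivity) (by positivity)]
  exact ENNReal.ofReal_le_ofReal (by nlinarith [sq_nonneg (a - b)])

lemma ofReal_sq_add_add_le (a b c : ℝ) :
    ENNReal.ofReal ((a + b + c) ^ 2) ≤
      3 * (ENNReal.ofReal (a ^ 2) + ENNReal.ofReal (b ^ 2) + ENNReal.ofReal (c ^ 2)) := by
  have h3 : (3 : ℝ≥0∞) = ENNReal.ofReal 3 := by simp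
  rw [h3, ← ENNReal.ofReal_add (by positivity) (by positivity),
    ← ENNReal.ofReal_add (by positivity) (by positivity), ← ENNReal.ofReal_mul zero_le_three]
  exact ENNReal.ofReal_le_ofReal
    (by nlinarith [sq_nonneg (a - b), sq_nonneg (a - c), sq_nonneg (b - c)])

end SampleMeans

/-! ### Independence of the two folds -/

section Folds

variable {E ι : Type*} [MeasurableSpace E] [Fintype ι]

/-- A sample indexed by `Bool × ι` splits into two independent folds. -/
lemma measurePreserving_folds (ρ : Measure E) [IsProbabilityMeasure ρ] (j : Bool) :
    MeasurePreserving (fun L : Bool × ι → E => ((fun i => L (!j, i)), fun i => L (j, i)))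
      (Measure.pi fun _ => ρ) ((Measure.pi fun _ => ρ).prod (Measure.pi fun _ => ρ)) := by
  classical
  -- `glue` is the inverse of the split. Testing on boxes shows that the law of the whole sample is
  -- the image under `glue` of the product of the fold laws, and splitting undoes `glue`.
  let glue : (ι → E) × (ι → E) → Bool × ι → E := fun S b => if b.1 = j then S.2 b.2 else S.1 b.2
  have hglue : Measurable glue := by
    refine measurable_pi_lambda _ fun b => ?_
    by_cases hb : b.1 = j
    · simp only [glue, hb, if_true]; fun_prop
    · simp only [glue, hb, if_false]; fun_prop
  have hmap : Measure.pi (fun _ : Bool × ι => ρ)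
      = Measure.map glue ((Measure.pi fun _ => ρ).prod (Measure.pi fun _ => ρ)) := by
    refine Measure.pi_eq fun s hs => ?_
    rw [Measure.map_apply hglue (MeasurableSet.univ_pi hs)]
    have hpre : glue ⁻¹' (Set.pi Set.univ s)
        = (Set.pi Set.univ fun i => s (!j, i)) ×ˢ (Set.pi Set.univ fun i => s (j, i)) := by
      ext S
      simp only [glue, Set.mem_preimage, Set.mem_univ_pi, Set.mem_prod, Prod.forall]
      cases j <;> simp [and_comm]
    rw [hpre, Measure.prod_prod, Measure.pi_pi, Measure.pi_pi, Fintype.prod_prod_type]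
    cases j <;> simp [mul_comm]
  have hsplit : Measurable
      (fun L : Bool × ι → E => ((fun i => L (!j, i)), fun i => L (j, i))) := by fun_prop
  refine ⟨hsplit, ?_⟩
  rw [hmap, Measure.map_map hsplit hglue]
  convert Measure.map_id using 2
  funext S
  simp only [glue, Function.comp_def, id]
  ext <;> simp

end Folds

/-! ### One fold with a frozen regression function -/

section FoldEstimate

variable {d N h : ℕ} {𝒱 : Type*} [MeasurableSpace 𝒱]

/-- The contribution of one fold to the cross-fitted mean estimator, for a fixed regression
function `e`. -/
noncomputable def foldEstimate (f : Rd d → ℝ) (e : 𝒱 → ℝ) (T : Fin N → Rd d × 𝒱)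
    (U : Fin h → 𝒱) : ℝ :=
  (1 / (2 * N : ℝ)) * ∑ i, (f (T i).1 - e (T i).2)
    + (1 / (2 * N + 2 * h : ℝ)) * (∑ i, e (T i).2 + ∑ i, e (U i))

/-- Each summand uses a regression function that depends on the opposite fold only, so it can be
analysed with that function fixed. The weights are those of the full sample. -/
lemma muHat_eq_foldEstimate (f : Rd d → ℝ) (u : (Fin N → Rd d × 𝒱) → 𝒱 → ℝ)
    (L : Bool × Fin N → Rd d × 𝒱) (U : Bool × Fin h → 𝒱) :
    muHat f u L U
      = foldEstimate f (u fun i => L (!true, i)) (fun i => L (true, i)) (fun i => U (true, i))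
        + foldEstimate f (u fun i => L (!false, i)) (fun i => L (false, i))
          (fun i => U (false, i)) := by
  simp only [muHat, foldEstimate, resid, fitLabelled, fitUnlabelled, crossFit,
    Fintype.sum_prod_type, Fintype.sum_bool]
  ring

variable {ρ : Measure (Rd d × 𝒱)} [IsProbabilityMeasure ρ] {f : Rd d → ℝ} {e : 𝒱 → ℝ}

/-- Split `e - m = -(f - e) + (f - m)`. The fitted values are thereby controlled by the residual
risk and the spread of `f`, with no further assumption on the regression. -/
lemma lintegral_fit_sub_sq_le (hfm : Measurable f) (he : Measurable e) (m : ℝ) :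
    ∫⁻ v, ENNReal.ofReal ((e v - m) ^ 2) ∂ρ.snd
      ≤ 2 * ∫⁻ z, ENNReal.ofReal ((f z.1 - e z.2) ^ 2) ∂ρ
        + 2 * ∫⁻ x, ENNReal.ofReal ((f x - m) ^ 2) ∂ρ.fst := by
  rw [Measure.snd, Measure.fst, lintegral_map (by fun_prop) measurable_snd,
    lintegral_map (by fun_prop) measurable_fst, ← lintegral_const_mul _ (by fun_prop),
    ← lintegral_const_mul _ (by fun_prop), ← lintegral_add_left (by fun_prop)]
  refine lintegral_mono fun z => ?_
  have h := ofReal_sq_add_le (-(f z.1 - e z.2)) (f z.1 - m)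
  rw [neg_sq] at h
  convert h using 3
  ring

lemma memLp_two_of_lintegral_sq {Ω : Type*} [MeasurableSpace Ω] {μ : Measure Ω} {g : Ω → ℝ}
    (hg : AEStronglyMeasurable g μ) (h : ∫⁻ x, ENNReal.ofReal (g x ^ 2) ∂μ < ∞) :
    MemLp g 2 μ := by
  rw [memLp_two_iff_integrable_sq hg]
  refine ⟨hg.pow 2, ?_⟩
  rw [hasFiniteIntegral_iff_ofReal (ae_of_all _ fun _ => sq_nonneg _)]
  exact h

/-- The `N + h` fitted terms have weight `(2N + 2h)⁻²` each, hence total weight `1/(4(N + h)) ≤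
1/(4N)`. This is why the unlabelled sample size may be arbitrary. -/
lemma fold_weights_le (hN : 1 ≤ N) (h : ℕ) {R V : ℝ≥0∞} (hR : R ≠ ∞) (hV : V ≠ ∞) :
    ENNReal.ofReal ((1 / (2 * N : ℝ)) ^ 2) * (N * R)
        + ENNReal.ofReal ((1 / (2 * N + 2 * h : ℝ)) ^ 2) * (N * (2 * R + 2 * V))
        + ENNReal.ofReal ((1 / (2 * N + 2 * h : ℝ)) ^ 2) * (h * (2 * R + 2 * V))
      ≤ ENNReal.ofReal (1 / N) * (R + V) := by
  have hN0 : (0 : ℝ) < N := by exact_mod_cast hN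
  have hh : (0 : ℝ) ≤ h := Nat.cast_nonneg h
  have h2 : (2 : ℝ≥0∞) = ENNReal.ofReal 2 := by simp
  obtain ⟨r, hr, rfl⟩ : ∃ r : ℝ, 0 ≤ r ∧ ENNReal.ofReal r = R :=
    ⟨R.toReal, ENNReal.toReal_nonneg, ENNReal.ofReal_toReal hR⟩
  obtain ⟨v, hv, rfl⟩ : ∃ v : ℝ, 0 ≤ v ∧ ENNReal.ofReal v = V :=
    ⟨V.toReal, ENNReal.toReal_nonneg, ENNReal.ofReal_toReal hV⟩
  rw [h2, ← ENNReal.ofReal_natCast N, ← ENNReal.ofReal_natCast h]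
  repeat first
    | rw [← ENNReal.ofReal_mul (by positivity)]
    | rw [← ENNReal.ofReal_add (by positivity) (by positivity)]
  refine ENNReal.ofReal_le_ofReal ?_
  have e1 : (1 / (2 * N : ℝ)) ^ 2 * (N * r) = r / (4 * N) := by field_simp; ring
  have e2 : (1 / (2 * N + 2 * h : ℝ)) ^ 2 * (N * (2 * r + 2 * v))
      + (1 / (2 * N + 2 * h : ℝ)) ^ 2 * (h * (2 * r + 2 * v)) = (r + v) / (2 * (N + h)) := by
    have : (N + h : ℝ) ≠ 0 := by positivity
    have : (2 * N + 2 * h : ℝ) ≠ 0 := by positivity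
    field_simp
  rw [add_assoc, e1, e2]
  have e3 : (r + v) / (2 * (N + h)) ≤ (r + v) / (2 * N) := by gcongr; linarith
  have e4 : 1 / (N : ℝ) * (r + v) - (r / (4 * N) + (r + v) / (2 * N))
      = (r + 2 * v) / (4 * N) := by
    field_simp
    ring
  have e5 : 0 ≤ (r + 2 * v) / (4 * N) := by positivity
  linarith

/-- The mean squared error of the contribution of one fold. -/
lemma lintegral_foldEstimate_sub_sq_le (hN : 1 ≤ N) (hfm : Measurable f)
    (hf : MemLp f 2 ρ.fst) (he : Measurable e) :
    ∫⁻ T, ∫⁻ U, ENNReal.ofReal ((foldEstimate f e T U - (∫ x, f x ∂ρ.fst) / 2) ^ 2)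
        ∂(Measure.pi fun _ : Fin h => ρ.snd) ∂(Measure.pi fun _ : Fin N => ρ)
      ≤ 3 * (ENNReal.ofReal (1 / N) * (∫⁻ z, ENNReal.ofReal ((f z.1 - e z.2) ^ 2) ∂ρ
          + evariance f ρ.fst)) := by
  set R := ∫⁻ z, ENNReal.ofReal ((f z.1 - e z.2) ^ 2) ∂ρ with hR
  set m := ∫ x, f x ∂ρ.fst with hm
  have hN0 : (0 : ℝ) < N := by exact_mod_cast hN
  have hc : ENNReal.ofReal (1 / N) ≠ 0 := by simpa using by positivity
  -- With infinite residual risk the bound is infinite. Otherwise the residual is in `L²`, and so is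
  -- `e`, as the difference of `f` and the residual.
  rcases eq_or_ne R ∞ with hRtop | hRtop
  · rw [hRtop, top_add, ENNReal.mul_top hc, ENNReal.mul_top three_ne_zero]; exact le_top
  have hr : MemLp (fun z : Rd d × 𝒱 => f z.1 - e z.2) 2 ρ :=
    memLp_two_of_lintegral_sq (by fun_prop) (lt_top_iff_ne_top.2 hRtop)
  have hf1 : MemLp (fun z : Rd d × 𝒱 => f z.1) 2 ρ :=
    hf.comp_measurePreserving ⟨measurable_fst, rfl⟩
  have he1 : MemLp (fun z : Rd d × 𝒱 => e z.2) 2 ρ := by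
    convert hf1.sub hr using 1
    funext z
    simp
  have he2 : MemLp e 2 ρ.snd := by
    rw [Measure.snd, memLp_map_measure_iff (by fun_prop) (by fun_prop)]
    exact he1
  have hEf : m = ∫ z, f z.1 ∂ρ := by
    rw [hm, Measure.fst, integral_map (by fun_prop) (by fun_prop)]
  have hEe : ∫ v, e v ∂ρ.snd = ∫ z, e z.2 ∂ρ := by
    rw [Measure.snd, integral_map (by fun_prop) (by fun_prop)]
  have hEr : ∫ z, (f z.1 - e z.2) ∂ρ = m - ∫ z, e z.2 ∂ρ := by
    rw [integral_sub (hf1.integrable one_le_two) (he1.integrable one_le_two), hEf]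
  set μe := ∫ z, e z.2 ∂ρ with hμe
  have hW : ∫⁻ v, ENNReal.ofReal ((e v - m) ^ 2) ∂ρ.snd ≤ 2 * R + 2 * evariance f ρ.fst := by
    rw [evariance_eq_lintegral_ofReal]
    exact lintegral_fit_sub_sq_le hfm he m
  have hW' : ∫⁻ z, ENNReal.ofReal ((e z.2 - m) ^ 2) ∂ρ ≤ 2 * R + 2 * evariance f ρ.fst := by
    refine le_trans (le_of_eq ?_) hW
    rw [Measure.snd, lintegral_map (by fun_prop) measurable_snd]
  -- The residuals have mean `m - μe` and the fitted values mean `μe`. A fold contains exactly half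
  -- of the labelled and half of all points, so the expectations add up to `m / 2` for every `e`.
  have hdecomp : ∀ (T : Fin N → Rd d × 𝒱) (U : Fin h → 𝒱),
      foldEstimate f e T U - m / 2
        = (1 / (2 * N : ℝ)) * ∑ i, ((f (T i).1 - e (T i).2) - (m - μe))
          + (1 / (2 * N + 2 * h : ℝ)) * ∑ i, (e (T i).2 - μe)
          + (1 / (2 * N + 2 * h : ℝ)) * ∑ i, (e (U i) - μe) := by
    intro T U
    have h2 : (2 * N + 2 * h : ℝ) ≠ 0 := by positivity
    simp only [foldEstimate, Finset.sum_sub_distrib, Finset.sum_const, Finset.card_univ,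
      Fintype.card_fin, nsmul_eq_mul]
    field_simp
    ring
  have hA : ∫⁻ T : Fin N → Rd d × 𝒱, ENNReal.ofReal
      (((1 / (2 * N : ℝ)) * ∑ i, ((f (T i).1 - e (T i).2) - (m - μe))) ^ 2)
      ∂(Measure.pi fun _ => ρ) ≤ ENNReal.ofReal ((1 / (2 * N : ℝ)) ^ 2) * (N * R) := by
    rw [lintegral_ofReal_mul_sq]
    gcongr
    -- Residuals are measured about `0`, which gives `R`; the fitted values below are measured about
    -- `m`.
    have := lintegral_sq_sum_sub_le (ι := Fin N) hr 0
    simpa only [hEr, sub_zero, Fintype.card_fin, ← hR] using this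
  have hB : ∫⁻ T : Fin N → Rd d × 𝒱, ENNReal.ofReal
      (((1 / (2 * N + 2 * h : ℝ)) * ∑ i, (e (T i).2 - μe)) ^ 2)
      ∂(Measure.pi fun _ => ρ)
      ≤ ENNReal.ofReal ((1 / (2 * N + 2 * h : ℝ)) ^ 2)
        * (N * (2 * R + 2 * evariance f ρ.fst)) := by
    rw [lintegral_ofReal_mul_sq]
    gcongr
    have := lintegral_sq_sum_sub_le (ι := Fin N) he1 m
    rw [Fintype.card_fin] at this
    exact this.trans (by gcongr)
  have hC : ∫⁻ U : Fin h → 𝒱, ENNReal.ofReal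
      (((1 / (2 * N + 2 * h : ℝ)) * ∑ i, (e (U i) - μe)) ^ 2)
      ∂(Measure.pi fun _ => ρ.snd)
      ≤ ENNReal.ofReal ((1 / (2 * N + 2 * h : ℝ)) ^ 2)
        * (h * (2 * R + 2 * evariance f ρ.fst)) := by
    rw [lintegral_ofReal_mul_sq]
    gcongr
    have := lintegral_sq_sum_sub_le (ι := Fin h) he2 m
    rw [Fintype.card_fin, hEe] at this
    exact this.trans (by gcongr)
  -- The first two sums run over the same points and are correlated, so the cross terms are absorbed
  -- in the factor `3`.
  calc _ ≤ ∫⁻ T : Fin N → Rd d × 𝒱, ∫⁻ U : Fin h → 𝒱, 3 * (ENNReal.ofReal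
      (((1 / (2 * N : ℝ)) * ∑ i, ((f (T i).1 - e (T i).2) - (m - μe))) ^ 2)
      + ENNReal.ofReal (((1 / (2 * N + 2 * h : ℝ)) * ∑ i, (e (T i).2 - μe)) ^ 2)
      + ENNReal.ofReal (((1 / (2 * N + 2 * h : ℝ)) * ∑ i, (e (U i) - μe)) ^ 2))
        ∂(Measure.pi fun _ => ρ.snd) ∂(Measure.pi fun _ => ρ) := by
        refine lintegral_mono fun T => lintegral_mono fun U => ?_
        simp only [hdecomp]
        exact ofReal_sq_add_add_le _ _ _
    _ ≤ 3 * (ENNReal.ofReal ((1 / (2 * N : ℝ)) ^ 2) * (N * R)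
        + ENNReal.ofReal ((1 / (2 * N + 2 * h : ℝ)) ^ 2) * (N * (2 * R + 2 * evariance f ρ.fst))
        + ENNReal.ofReal ((1 / (2 * N + 2 * h : ℝ)) ^ 2)
          * (h * (2 * R + 2 * evariance f ρ.fst))) := by
        simp only [lintegral_const_mul' _ _ ENNReal.ofNat_ne_top]
        gcongr
        simp only [lintegral_add_left measurable_const, lintegral_const, measure_univ, mul_one]
        rw [lintegral_add_right _ measurable_const, lintegral_add_right _ (by fun_prop),
          lintegral_const, measure_univ, mul_one]
        gcongr
    _ ≤ 3 * (ENNReal.ofReal (1 / N) * (R + evariance f ρ.fst)) := by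
        gcongr
        exact fold_weights_le hN h hRtop (evariance_ne_top hf)

lemma lintegral_pi_sum {Ω ι : Type*} [MeasurableSpace Ω] [Fintype ι] (ν : Measure Ω)
    [IsProbabilityMeasure ν] {g : Ω → ℝ≥0∞} (hg : Measurable g) :
    ∫⁻ x, ∑ i : ι, g (x i) ∂(Measure.pi fun _ => ν) = Fintype.card ι * ∫⁻ y, g y ∂ν := by
  rw [lintegral_finsetSum _ fun i _ => by fun_prop]
  have : ∀ i : ι, ∫⁻ x : ι → Ω, g (x i) ∂(Measure.pi fun _ => ν) = ∫⁻ y, g y ∂ν := fun i =>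
    (measurePreserving_eval (fun _ : ι => ν) i).lintegral_comp hg
  simp [this]

/-- The contribution of one fold to an upper bound for the variance estimator. -/
noncomputable def foldSquares (f : Rd d → ℝ) (e : 𝒱 → ℝ) (m : ℝ) (T : Fin N → Rd d × 𝒱)
    (U : Fin h → 𝒱) : ℝ≥0∞ :=
  ENNReal.ofReal ((1 / (2 * N : ℝ)) ^ 2) * ∑ i, ENNReal.ofReal ((f (T i).1 - e (T i).2) ^ 2)
    + ENNReal.ofReal ((1 / (2 * N + 2 * h : ℝ)) ^ 2) * ∑ i, ENNReal.ofReal ((e (T i).2 - m) ^ 2)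
    + ENNReal.ofReal ((1 / (2 * N + 2 * h : ℝ)) ^ 2) * ∑ i, ENNReal.ofReal ((e (U i) - m) ^ 2)

/-- Here `A` and `Q` stand for the sum and the sum of squares of `n` numbers. Recentring them at `m`
instead of their mean adds the square of `mean - m`. -/
lemma empirical_variance_le {A Q n : ℝ} (hn : n ≠ 0) (m : ℝ) :
    (1 / n) * Q - ((1 / n) * A) ^ 2 ≤ (1 / n) * (Q - 2 * m * A + n * m ^ 2) := by
  have : (1 / n) * (Q - 2 * m * A + n * m ^ 2) - ((1 / n) * Q - ((1 / n) * A) ^ 2)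
      = ((1 / n) * A - m) ^ 2 := by
    field_simp
    ring
  nlinarith [sq_nonneg ((1 / n) * A - m)]

/-- The empirical means couple the two folds. Replacing them by the constants `0` for the residuals
and `m` for the fitted values only increases the estimate, and what remains is a sum over folds. -/
lemma ofReal_sigmaSq_le (hN : 1 ≤ N) (f : Rd d → ℝ) (u : (Fin N → Rd d × 𝒱) → 𝒱 → ℝ)
    (m : ℝ) (L : Bool × Fin N → Rd d × 𝒱) (U : Bool × Fin h → 𝒱) :
    ENNReal.ofReal (sigmaSq f u L U)
      ≤ foldSquares f (u fun i => L (!true, i)) m (fun i => L (true, i)) (fun i => U (true, i))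
        + foldSquares f (u fun i => L (!false, i)) m (fun i => L (false, i))
          (fun i => U (false, i)) := by
  have hN0 : (0 : ℝ) < N := by exact_mod_cast hN
  have hn : (2 * N + 2 * h : ℝ) ≠ 0 := by positivity
  simp only [foldSquares]
  repeat rw [← ENNReal.ofReal_sum_of_nonneg fun _ _ => by positivity]
  repeat rw [← ENNReal.ofReal_mul (by positivity)]
  repeat rw [← ENNReal.ofReal_add (by positivity) (by positivity)]
  refine ENNReal.ofReal_le_ofReal ?_
  have h1 : sigmaSqOne f u L ≤ (1 / (2 * N : ℝ)) * ∑ i, resid f u L i ^ 2 :=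
    sub_le_self _ (sq_nonneg _)
  have h2 : sigmaSqTwo u L U ≤ (1 / (2 * N + 2 * h : ℝ)) *
      (∑ i, (fitLabelled u L i - m) ^ 2 + ∑ i, (fitUnlabelled u L U i - m) ^ 2) := by
    refine (empirical_variance_le hn m).trans (le_of_eq ?_)
    congr 1
    simp only [sub_sq, Finset.sum_add_distrib, Finset.sum_sub_distrib, Finset.sum_const,
      Finset.card_univ, Fintype.card_prod, Fintype.card_bool, Fintype.card_fin, nsmul_eq_mul,
      ← Finset.sum_mul, ← Finset.mul_sum]
    push_cast
    ring
  have h3 : sigmaSq f u L U ≤ (1 / (2 * N : ℝ)) * ((1 / (2 * N : ℝ)) * ∑ i, resid f u L i ^ 2)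
      + (1 / (2 * N + 2 * h : ℝ)) * ((1 / (2 * N + 2 * h : ℝ)) *
      (∑ i, (fitLabelled u L i - m) ^ 2 + ∑ i, (fitUnlabelled u L U i - m) ^ 2)) := by
    unfold sigmaSq
    gcongr
  refine h3.trans (le_of_eq ?_)
  simp only [resid, fitLabelled, fitUnlabelled, crossFit, Fintype.sum_prod_type, Fintype.sum_bool]
  ring

lemma lintegral_foldSquares_le (hN : 1 ≤ N) (hfm : Measurable f)
    (hf : MemLp f 2 ρ.fst) (he : Measurable e) :
    ∫⁻ T, ∫⁻ U, foldSquares f e (∫ x, f x ∂ρ.fst) T U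
        ∂(Measure.pi fun _ : Fin h => ρ.snd) ∂(Measure.pi fun _ : Fin N => ρ)
      ≤ ENNReal.ofReal (1 / N) * (∫⁻ z, ENNReal.ofReal ((f z.1 - e z.2) ^ 2) ∂ρ
          + evariance f ρ.fst) := by
  set R := ∫⁻ z, ENNReal.ofReal ((f z.1 - e z.2) ^ 2) ∂ρ with hR
  have hN0 : (0 : ℝ) < N := by exact_mod_cast hN
  have hc : ENNReal.ofReal (1 / N) ≠ 0 := by simpa using by positivity
  rcases eq_or_ne R ∞ with hRtop | hRtop
  · rw [hRtop, top_add, ENNReal.mul_top hc]; exact le_top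
  have hW := lintegral_fit_sub_sq_le (ρ := ρ) hfm he (∫ x, f x ∂ρ.fst)
  rw [← evariance_eq_lintegral_ofReal, ← hR] at hW
  have hW' : ∫⁻ z, ENNReal.ofReal ((e z.2 - ∫ x, f x ∂ρ.fst) ^ 2) ∂ρ
      ≤ 2 * R + 2 * evariance f ρ.fst := by
    refine le_trans (le_of_eq ?_) hW
    rw [Measure.snd, lintegral_map (by fun_prop) measurable_snd]
  refine le_trans ?_ (fold_weights_le hN h hRtop (evariance_ne_top hf))
  simp only [foldSquares]
  simp only [lintegral_add_left measurable_const, lintegral_const, measure_univ, mul_one]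
  rw [lintegral_add_right _ measurable_const, lintegral_add_right _ (by fun_prop),
    lintegral_const, measure_univ, mul_one]
  simp only [lintegral_const_mul' _ _ ENNReal.ofReal_ne_top]
  rw [lintegral_pi_sum ρ (g := fun z => ENNReal.ofReal ((f z.1 - e z.2) ^ 2)) (by fun_prop),
    lintegral_pi_sum ρ (g := fun z => ENNReal.ofReal ((e z.2 - ∫ x, f x ∂ρ.fst) ^ 2))
      (by fun_prop),
    lintegral_pi_sum ρ.snd (g := fun v => ENNReal.ofReal ((e v - ∫ x, f x ∂ρ.fst) ^ 2))
      (by fun_prop)]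
  simp only [Fintype.card_fin]
  gcongr

end FoldEstimate

/-! ### Conditioning on the training fold -/

section CrossFitBounds

variable {d N h : ℕ} {𝒱 : Type*} [MeasurableSpace 𝒱]
  {ρ : Measure (Rd d × 𝒱)} [IsProbabilityMeasure ρ] {f : Rd d → ℝ}
  {u : (Fin N → Rd d × 𝒱) → 𝒱 → ℝ}

/-- The training fold `S`, the evaluation fold `T` and the unlabelled fold `U` are independent, so
the two inner integrals see a fixed regression function. The other unlabelled fold integrates out.
-/
lemma lintegral_fold (ρ : Measure (Rd d × 𝒱)) [IsProbabilityMeasure ρ] (j : Bool)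
    {G : (Fin N → Rd d × 𝒱) → (Fin N → Rd d × 𝒱) → (Fin h → 𝒱) → ℝ≥0∞}
    (hG : Measurable fun p : ((Fin N → Rd d × 𝒱) × (Fin N → Rd d × 𝒱)) × (Fin h → 𝒱) =>
      G p.1.1 p.1.2 p.2) :
    ∫⁻ x : (Bool × Fin N → Rd d × 𝒱) × (Bool × Fin h → 𝒱),
        G (fun i => x.1 (!j, i)) (fun i => x.1 (j, i)) (fun i => x.2 (j, i))
        ∂((Measure.pi fun _ => ρ).prod (Measure.pi fun _ => ρ.snd))
      = ∫⁻ S, ∫⁻ T, ∫⁻ U, G S T U ∂(Measure.pi fun _ => ρ.snd) ∂(Measure.pi fun _ => ρ)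
          ∂(Measure.pi fun _ => ρ) := by
  have h1 := measurePreserving_folds (ι := Fin N) ρ j
  have h2 : MeasurePreserving (fun U : Bool × Fin h → 𝒱 => fun i => U (j, i))
      (Measure.pi fun _ => ρ.snd) (Measure.pi fun _ => ρ.snd) :=
    measurePreserving_snd.comp (measurePreserving_folds (ι := Fin h) ρ.snd j)
  have h3 := (h1.prod h2).lintegral_comp hG
  simp only [Prod.map_fst, Prod.map_snd] at h3
  rw [h3, lintegral_prod _ hG.aemeasurable, lintegral_prod _ hG.lintegral_prod_right'.aemeasurable]

lemma measurable_foldEstimate_uncurry (hfm : Measurable f)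
    (hu : Measurable fun z : (Fin N → Rd d × 𝒱) × 𝒱 => u z.1 z.2) :
    Measurable fun p : ((Fin N → Rd d × 𝒱) × (Fin N → Rd d × 𝒱)) × (Fin h → 𝒱) =>
      foldEstimate f (u p.1.1) p.1.2 p.2 := by
  have h1 : ∀ i : Fin N, Measurable fun p : ((Fin N → Rd d × 𝒱) × (Fin N → Rd d × 𝒱))
      × (Fin h → 𝒱) => u p.1.1 (p.1.2 i).2 := fun i =>
    hu.comp (f := fun p : ((Fin N → Rd d × 𝒱) × (Fin N → Rd d × 𝒱)) × (Fin h → 𝒱) =>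
      (p.1.1, (p.1.2 i).2)) (by fun_prop)
  have h2 : ∀ i : Fin h, Measurable fun p : ((Fin N → Rd d × 𝒱) × (Fin N → Rd d × 𝒱))
      × (Fin h → 𝒱) => u p.1.1 (p.2 i) := fun i =>
    hu.comp (f := fun p : ((Fin N → Rd d × 𝒱) × (Fin N → Rd d × 𝒱)) × (Fin h → 𝒱) =>
      (p.1.1, p.2 i)) (by fun_prop)
  unfold foldEstimate
  fun_prop

lemma measurable_foldSquares_uncurry (hfm : Measurable f)
    (hu : Measurable fun z : (Fin N → Rd d × 𝒱) × 𝒱 => u z.1 z.2) (m : ℝ) :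
    Measurable fun p : ((Fin N → Rd d × 𝒱) × (Fin N → Rd d × 𝒱)) × (Fin h → 𝒱) =>
      foldSquares f (u p.1.1) m p.1.2 p.2 := by
  have h1 : ∀ i : Fin N, Measurable fun p : ((Fin N → Rd d × 𝒱) × (Fin N → Rd d × 𝒱))
      × (Fin h → 𝒱) => u p.1.1 (p.1.2 i).2 := fun i =>
    hu.comp (f := fun p : ((Fin N → Rd d × 𝒱) × (Fin N → Rd d × 𝒱)) × (Fin h → 𝒱) =>
      (p.1.1, (p.1.2 i).2)) (by fun_prop)
  have h2 : ∀ i : Fin h, Measurable fun p : ((Fin N → Rd d × 𝒱) × (Fin N → Rd d × 𝒱))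
      × (Fin h → 𝒱) => u p.1.1 (p.2 i) := fun i =>
    hu.comp (f := fun p : ((Fin N → Rd d × 𝒱) × (Fin N → Rd d × 𝒱)) × (Fin h → 𝒱) =>
      (p.1.1, p.2 i)) (by fun_prop)
  unfold foldSquares
  fun_prop

/-- The mean squared error of the cross-fitted mean estimator. -/
lemma lintegral_muHat_sub_sq_le (hN : 1 ≤ N) (hfm : Measurable f) (hf : MemLp f 2 ρ.fst)
    (hu : Measurable fun z : (Fin N → Rd d × 𝒱) × 𝒱 => u z.1 z.2) :
    ∫⁻ x : (Bool × Fin N → Rd d × 𝒱) × (Bool × Fin h → 𝒱),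
        ENNReal.ofReal ((muHat f u x.1 x.2 - ∫ x, f x ∂ρ.fst) ^ 2)
        ∂((Measure.pi fun _ => ρ).prod (Measure.pi fun _ => ρ.snd))
      ≤ 12 * (ENNReal.ofReal (1 / N) *
        (∫⁻ S, ∫⁻ z, ENNReal.ofReal ((f z.1 - u S z.2) ^ 2) ∂ρ ∂(Measure.pi fun _ => ρ)
          + evariance f ρ.fst)) := by
  set m := ∫ x, f x ∂ρ.fst with hm
  set B := ENNReal.ofReal (1 / N) *
        (∫⁻ S, ∫⁻ z, ENNReal.ofReal ((f z.1 - u S z.2) ^ 2) ∂ρ ∂(Measure.pi fun _ : Fin N => ρ)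
          + evariance f ρ.fst) with hB
  have hus : ∀ S, Measurable (u S) := fun S => hu.comp measurable_prodMk_left
  have hmeas := measurable_foldEstimate_uncurry (h := h) hfm hu
  have hfold : ∀ j : Bool, ∫⁻ x : (Bool × Fin N → Rd d × 𝒱) × (Bool × Fin h → 𝒱),
      ENNReal.ofReal ((foldEstimate f (u fun i => x.1 (!j, i)) (fun i => x.1 (j, i))
        (fun i => x.2 (j, i)) - m / 2) ^ 2)
        ∂((Measure.pi fun _ => ρ).prod (Measure.pi fun _ => ρ.snd)) ≤ 3 * B := by
    intro j
    rw [lintegral_fold ρ j (G := fun S T U =>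
      ENNReal.ofReal ((foldEstimate f (u S) T U - m / 2) ^ 2)) (by fun_prop)]
    refine (lintegral_mono fun S => lintegral_foldEstimate_sub_sq_le hN hfm hf
      (hus S)).trans (le_of_eq ?_)
    rw [lintegral_const_mul' _ _ ENNReal.ofNat_ne_top,
      lintegral_const_mul' _ _ ENNReal.ofReal_ne_top, lintegral_add_right _ measurable_const,
      lintegral_const, measure_univ, mul_one]
  calc _ ≤ ∫⁻ x : (Bool × Fin N → Rd d × 𝒱) × (Bool × Fin h → 𝒱),
        (2 * ENNReal.ofReal ((foldEstimate f (u fun i => x.1 (!true, i)) (fun i => x.1 (true, i))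
        (fun i => x.2 (true, i)) - m / 2) ^ 2)
        + 2 * ENNReal.ofReal ((foldEstimate f (u fun i => x.1 (!false, i))
          (fun i => x.1 (false, i)) (fun i => x.2 (false, i)) - m / 2) ^ 2))
        ∂((Measure.pi fun _ => ρ).prod (Measure.pi fun _ => ρ.snd)) := by
        refine lintegral_mono fun x => ?_
        rw [muHat_eq_foldEstimate]
        refine le_trans (le_of_eq ?_) (ofReal_sq_add_le _ _)
        congr 2
        ring
    _ ≤ 2 * (3 * B) + 2 * (3 * B) := by
        rw [lintegral_add_left ?_, lintegral_const_mul' _ _ ENNReal.ofNat_ne_top,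
          lintegral_const_mul' _ _ ENNReal.ofNat_ne_top]
        · gcongr
          · exact hfold true
          · exact hfold false
        · have := hmeas.comp (f := fun x : (Bool × Fin N → Rd d × 𝒱) × (Bool × Fin h → 𝒱) =>
            (((fun i => x.1 (!true, i)), fun i => x.1 (true, i)), fun i => x.2 (true, i)))
            (by fun_prop)
          simp only [Function.comp_def] at this
          fun_prop
    _ = 12 * B := by ring

/-- The mean of the cross-fitted variance estimator. -/
lemma lintegral_sigmaSq_le (hN : 1 ≤ N) (hfm : Measurable f) (hf : MemLp f 2 ρ.fst)
    (hu : Measurable fun z : (Fin N → Rd d × 𝒱) × 𝒱 => u z.1 z.2) :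
    ∫⁻ x : (Bool × Fin N → Rd d × 𝒱) × (Bool × Fin h → 𝒱),
        ENNReal.ofReal (sigmaSq f u x.1 x.2)
        ∂((Measure.pi fun _ => ρ).prod (Measure.pi fun _ => ρ.snd))
      ≤ 2 * (ENNReal.ofReal (1 / N) *
        (∫⁻ S, ∫⁻ z, ENNReal.ofReal ((f z.1 - u S z.2) ^ 2) ∂ρ ∂(Measure.pi fun _ => ρ)
          + evariance f ρ.fst)) := by
  set m := ∫ x, f x ∂ρ.fst with hm
  set B := ENNReal.ofReal (1 / N) *
        (∫⁻ S, ∫⁻ z, ENNReal.ofReal ((f z.1 - u S z.2) ^ 2) ∂ρ ∂(Measure.pi fun _ : Fin N => ρ)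
          + evariance f ρ.fst) with hB
  have hus : ∀ S, Measurable (u S) := fun S => hu.comp measurable_prodMk_left
  have hmeas := measurable_foldSquares_uncurry (h := h) hfm hu m
  have hfold : ∀ j : Bool, ∫⁻ x : (Bool × Fin N → Rd d × 𝒱) × (Bool × Fin h → 𝒱),
      foldSquares f (u fun i => x.1 (!j, i)) m (fun i => x.1 (j, i)) (fun i => x.2 (j, i))
        ∂((Measure.pi fun _ => ρ).prod (Measure.pi fun _ => ρ.snd)) ≤ B := by
    intro j
    rw [lintegral_fold ρ j (G := fun S T U => foldSquares f (u S) m T U) hmeas]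
    refine (lintegral_mono fun S => lintegral_foldSquares_le hN hfm hf
      (hus S)).trans (le_of_eq ?_)
    rw [lintegral_const_mul' _ _ ENNReal.ofReal_ne_top, lintegral_add_right _ measurable_const,
      lintegral_const, measure_univ, mul_one]
  have hmeas' : Measurable fun x : (Bool × Fin N → Rd d × 𝒱) × (Bool × Fin h → 𝒱) =>
      foldSquares f (u fun i => x.1 (!true, i)) m (fun i => x.1 (true, i))
        (fun i => x.2 (true, i)) :=
    hmeas.comp (f := fun x : (Bool × Fin N → Rd d × 𝒱) × (Bool × Fin h → 𝒱) =>
      (((fun i => x.1 (!true, i)), fun i => x.1 (true, i)), fun i => x.2 (true, i)))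
      (by fun_prop)
  calc _ ≤ ∫⁻ x : (Bool × Fin N → Rd d × 𝒱) × (Bool × Fin h → 𝒱),
        (foldSquares f (u fun i => x.1 (!true, i)) m (fun i => x.1 (true, i))
          (fun i => x.2 (true, i))
        + foldSquares f (u fun i => x.1 (!false, i)) m (fun i => x.1 (false, i))
          (fun i => x.2 (false, i)))
        ∂((Measure.pi fun _ => ρ).prod (Measure.pi fun _ => ρ.snd)) :=
        lintegral_mono fun x => ofReal_sigmaSq_le hN f u m x.1 x.2
    _ ≤ B + B := by
        rw [lintegral_add_left hmeas']
        exact add_le_add (hfold true) (hfold false)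
    _ = 2 * B := (two_mul B).symm

end CrossFitBounds

/-! ### Plancherel and the Fourier form of the Gaussian energy -/

section Fourier

variable {d : ℕ}

open SchwartzMap in
/-- An integrable function whose Fourier transform is square integrable is itself square
integrable, with the same `L²` norm. -/
theorem eLpNorm_two_eq_fourier {g : Rd d → ℂ} (hg : Integrable g) (hF : MemLp (𝓕 g) 2) :
    eLpNorm g 2 volume = eLpNorm (𝓕 g) 2 volume := by
  set h : Lp ℂ 2 (volume : Measure (Rd d)) := hF.toLp with hh
  set k : Lp ℂ 2 (volume : Measure (Rd d)) := 𝓕⁻ h with hk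
  -- `g` is not known to be in `L²`, so it is compared with `k`, the `L²` inverse transform of `𝓕
  -- g`, by pairing with smooth compactly supported functions. Moving `𝓕⁻` from `k` to the test
  -- function, and then `𝓕` back from `g`, makes the two pairings equal. The norm identity then
  -- comes from the isometry on `L²`.
  have key : g =ᵐ[volume] k := by
    refine ae_eq_of_integral_contDiff_smul_eq hg.locallyIntegrable
      ((Lp.memLp k).locallyIntegrable one_le_two) fun φ hφ hφc => ?_
    have hφ₁ : HasCompactSupport (Complex.ofRealCLM ∘ φ) := hφc.comp_left rfl
    have hφ₂ : ContDiff ℝ (⊤ : ℕ∞) (Complex.ofRealCLM ∘ φ) := by fun_prop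
    set ψ : 𝓢(Rd d, ℂ) := hφ₁.toSchwartzMap hφ₂ with hψ
    have h1 : ∫ x, φ x • (k : Rd d → ℂ) x = Lp.toTemperedDistribution k ψ := by
      simp [hψ]
    have h2 : Lp.toTemperedDistribution k ψ = ∫ x, (𝓕⁻ ψ : 𝓢(Rd d, ℂ)) x • 𝓕 g x := by
      rw [hk, ← Lp.fourierInv_toTemperedDistribution_eq, TemperedDistribution.fourierInv_apply,
        Lp.toTemperedDistribution_apply]
      refine integral_congr_ae ?_
      filter_upwards [hF.coeFn_toLp] with x hx
      rw [hh, hx]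
    have h3 : ∫ x, (𝓕⁻ ψ : 𝓢(Rd d, ℂ)) x • 𝓕 g x
        = ∫ x, 𝓕 ((𝓕⁻ ψ : 𝓢(Rd d, ℂ)) : Rd d → ℂ) x • g x := by
      simpa using! (VectorFourier.integral_fourierIntegral_smul_eq_flip (L := innerₗ (Rd d))
        Real.continuous_fourierChar continuous_inner
        ((𝓕⁻ ψ : 𝓢(Rd d, ℂ)).integrable) hg).symm
    rw [h1, h2, h3, ← SchwartzMap.fourier_coe, FourierTransform.fourier_fourierInv_eq]
    simp [hψ]
  rw [eLpNorm_congr_ae key]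
  have hn : ‖k‖ = ‖h‖ := by
    rw [← Lp.norm_fourier_eq k, hk, FourierTransform.fourier_fourierInv_eq]
  have : ENNReal.ofReal ‖k‖ = ENNReal.ofReal ‖h‖ := by rw [hn]
  rw [Lp.norm_def, Lp.norm_def, ENNReal.ofReal_toReal (Lp.eLpNorm_ne_top _),
    ENNReal.ofReal_toReal (Lp.eLpNorm_ne_top _)] at this
  rw [this, hh, eLpNorm_congr_ae hF.coeFn_toLp]

/-- A Gaussian of parameter `π²/s` transforms into one of parameter `s`, the modulation by `x`
shifts its centre, and the prefactor cancels the normalization. In this form the transform can be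
moved onto the other factor of an integral. -/
lemma gaussianKernel_eq_fourier {s : ℝ} (hs : 0 < s) (x y : Rd d) :
    (gaussianKernel s x y : ℂ) = (Real.pi / s : ℂ) ^ (d / 2 : ℂ) *
      𝓕 (fun v : Rd d => Complex.exp (-(Real.pi ^ 2 / s : ℝ) * ‖v‖ ^ 2
        + 2 * Real.pi * Complex.I * inner ℝ x v)) y := by
  have hb : 0 < ((Real.pi ^ 2 / s : ℝ) : ℂ).re := by
    rw [Complex.ofReal_re]; positivity
  rw [fourier_gaussian_innerProductSpace' hb, ← mul_assoc]
  have hπ : (Real.pi : ℂ) ≠ 0 := by exact_mod_cast Real.pi_ne_zero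
  have hsC : (s : ℂ) ≠ 0 := by exact_mod_cast hs.ne'
  have h1 : (Real.pi / s : ℂ) ^ (d / 2 : ℂ) * (Real.pi / ((Real.pi ^ 2 / s : ℝ) : ℂ)) ^
      (Module.finrank ℝ (Rd d) / 2 : ℂ) = 1 := by
    have e1 : (Real.pi / s : ℂ) = ((Real.pi / s : ℝ) : ℂ) := by push_cast; rfl
    have e2 : (Real.pi / ((Real.pi ^ 2 / s : ℝ) : ℂ)) = ((s / Real.pi : ℝ) : ℂ) := by
      push_cast; field_simp
    rw [finrank_euclideanSpace_fin, e1, e2,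
      ← Complex.mul_cpow_ofReal_nonneg (by positivity) (by positivity), ← Complex.ofReal_mul]
    have : Real.pi / s * (s / Real.pi) = 1 := by
      have := hs.ne'; have := Real.pi_ne_zero; field_simp
    rw [this]; simp
  rw [h1, one_mul, gaussianKernel, Complex.ofReal_exp]
  congr 1
  push_cast
  field_simp

/-- The energy of the Gaussian kernel in terms of the Fourier transform. -/
theorem integral_gaussianKernel_mul_mul {s : ℝ} (hs : 0 < s) {g : Rd d → ℝ} (hg : Integrable g) :
    ∫ x, g x * ∫ y, gaussianKernel s x y * g y
      = (Real.pi / s) ^ (d / 2 : ℝ) * ∫ ω : Rd d, Real.exp (-(Real.pi ^ 2 / s) * ‖ω‖ ^ 2) *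
          ‖𝓕 (fun x : Rd d => (g x : ℂ)) ω‖ ^ 2 := by
  set G : Rd d → ℂ := fun x => (g x : ℂ) with hGdef
  have hG : Integrable G := hg.ofReal
  have hb : 0 < ((Real.pi ^ 2 / s : ℝ) : ℂ).re := by
    rw [Complex.ofReal_re]; positivity
  set c : ℂ := (Real.pi / s : ℂ) ^ (d / 2 : ℂ) with hc
  have hcr : c = (((Real.pi / s) ^ (d / 2 : ℝ) : ℝ) : ℂ) := by
    rw [Complex.ofReal_cpow (by positivity)]; push_cast; rfl
  let e : Rd d → Rd d → ℂ := fun x v => Complex.exp (-(Real.pi ^ 2 / s : ℝ) * ‖v‖ ^ 2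
        + 2 * Real.pi * Complex.I * inner ℝ x v)
  have he : ∀ x, Integrable (e x) := fun x =>
    GaussianFourier.integrable_cexp_neg_mul_sq_norm_add hb _ _
  have h1 : ∀ x, ((∫ y, gaussianKernel s x y * g y : ℝ) : ℂ) = c * ∫ v, e x v * 𝓕 G v := by
    intro x
    have hflip : ∫ y, 𝓕 (e x) y • G y = ∫ v, e x v • 𝓕 G v := by
      simpa using! (VectorFourier.integral_fourierIntegral_smul_eq_flip (L := innerₗ (Rd d))
        Real.continuous_fourierChar continuous_inner (he x) hG)
    simp only [smul_eq_mul] at hflip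
    rw [← hflip, ← integral_const_mul, ← integral_complex_ofReal]
    refine integral_congr_ae (ae_of_all _ fun y => ?_)
    simp only [Complex.ofReal_mul]
    rw [gaussianKernel_eq_fourier hs, mul_assoc]
  have hFm : Continuous (𝓕 G) := by
    exact VectorFourier.fourierIntegral_continuous Real.continuous_fourierChar continuous_inner hG
  have hFb : ∀ v, ‖𝓕 G v‖ ≤ ∫ x, ‖G x‖ := fun v =>
    VectorFourier.norm_fourierIntegral_le_integral_norm _ _ _ _ _
  have hexp : Integrable fun v : Rd d => Complex.exp (-(Real.pi ^ 2 / s : ℝ) * ‖v‖ ^ 2) := by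
    simpa using GaussianFourier.integrable_cexp_neg_mul_sq_norm_add hb 0 (0 : Rd d)
  have hexpF : Integrable fun v : Rd d =>
      Complex.exp (-(Real.pi ^ 2 / s : ℝ) * ‖v‖ ^ 2) * 𝓕 G v :=
    hexp.mul_bdd hFm.aestronglyMeasurable (ae_of_all _ hFb)
  -- Up to a factor of modulus one this is the product of an integrable function of `x` and one of
  -- `v`, so Fubini applies.
  have hprod : Integrable (Function.uncurry fun x v => G x * (e x v * 𝓕 G v))
      ((volume : Measure (Rd d)).prod volume) := by
    have hcont : Continuous fun p : Rd d × Rd d =>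
        Complex.exp (2 * Real.pi * Complex.I * inner ℝ p.1 p.2) := by fun_prop
    refine ((hG.mul_prod hexpF).mul_bdd (c := 1) hcont.aestronglyMeasurable
      (ae_of_all _ fun p => ?_)).congr (ae_of_all _ fun p => ?_)
    · rw [Complex.norm_exp]
      simp
    · simp only [Function.uncurry, e, Complex.exp_add]
      ring
  have h2 : ∀ v, ∫ x, G x * (e x v * 𝓕 G v)
      = ((Real.exp (-(Real.pi ^ 2 / s) * ‖v‖ ^ 2) * ‖𝓕 G v‖ ^ 2 : ℝ) : ℂ) := by
    intro v
    -- Since `g` is real, conjugating its transform only flips the phase. This produces `|𝓕 G|²`.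
    have hconj : (starRingEnd ℂ) (𝓕 G v)
        = ∫ x, G x * Complex.exp (2 * Real.pi * Complex.I * inner ℝ x v) := by
      rw [Real.fourier_eq', ← integral_conj]
      refine integral_congr_ae (ae_of_all _ fun x => ?_)
      simp only [smul_eq_mul, map_mul, ← Complex.exp_conj, hGdef, Complex.conj_ofReal,
        Complex.conj_I]
      rw [mul_comm]
      congr 2
      push_cast
      ring
    have : ∫ x, G x * (e x v * 𝓕 G v)
        = Complex.exp (-(Real.pi ^ 2 / s : ℝ) * ‖v‖ ^ 2) * (𝓕 G v *
          ∫ x, G x * Complex.exp (2 * Real.pi * Complex.I * inner ℝ x v)) := by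
      rw [← integral_const_mul, ← integral_const_mul]
      refine integral_congr_ae (ae_of_all _ fun x => ?_)
      simp only [e, Complex.exp_add]
      ring
    rw [this, ← hconj, Complex.mul_conj, Complex.normSq_eq_norm_sq]
    push_cast
    rfl
  have h3 : ((∫ x, g x * ∫ y, gaussianKernel s x y * g y : ℝ) : ℂ)
      = c * ∫ v, ∫ x, G x * (e x v * 𝓕 G v) := by
    rw [← integral_integral_swap hprod, ← integral_const_mul, ← integral_complex_ofReal]
    refine integral_congr_ae (ae_of_all _ fun x => ?_)
    simp only [Complex.ofReal_mul]
    rw [h1 x, integral_const_mul]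
    simp only [hGdef]
    ring
  apply Complex.ofReal_injective
  rw [h3, hcr, Complex.ofReal_mul, ← integral_complex_ofReal]
  simp only [h2]

end Fourier

/-! ### Frequency truncation in the Sobolev ball -/

section Sobolev

variable {d : ℕ} {β M : ℝ}

/-- The Fourier transform of a real function. -/
noncomputable def fourierReal (f : Rd d → ℝ) : Rd d → ℂ := 𝓕 (fun x : Rd d => (f x : ℂ))

lemma continuous_fourierReal {f : Rd d → ℝ} (hf : Integrable f) : Continuous (fourierReal f) :=
  VectorFourier.fourierIntegral_continuous Real.continuous_fourierChar continuous_inner hf.ofReal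

lemma fourierReal_sub {p q : Rd d → ℝ} (hp : Integrable p) (hq : Integrable q) (ω : Rd d) :
    fourierReal (p - q) ω = fourierReal p ω - fourierReal q ω := by
  have hp' : Integrable fun x : Rd d => (p x : ℂ) := hp.ofReal
  have hq' : Integrable fun x : Rd d => (q x : ℂ) := hq.ofReal
  simp only [fourierReal, Real.fourier_eq]
  rw [← integral_sub]
  · simp [smul_sub]
  · exact (Real.fourierIntegral_convergent_iff ω).2 hp'
  · exact (Real.fourierIntegral_convergent_iff ω).2 hq'

lemma one_le_weight (hβ : 0 < β) (ω : Rd d) : 1 ≤ (1 + ‖ω‖ ^ 2) ^ β :=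
  Real.one_le_rpow (by nlinarith [sq_nonneg ‖ω‖]) hβ.le

lemma continuous_weight : Continuous fun ω : Rd d => (1 + ‖ω‖ ^ 2) ^ β :=
  Continuous.rpow_const (by fun_prop) fun ω => Or.inl (by positivity)

lemma pos_of_mem_sobolevBall {f : Rd d → ℝ} (hf : f ∈ sobolevBall d β M) : 0 < M :=
  ENNReal.ofReal_pos.1 (bot_le.trans_lt hf.2.2)

lemma integrable_weighted_of_mem_sobolevBall {f : Rd d → ℝ} (hf : f ∈ sobolevBall d β M) :
    Integrable fun ω : Rd d => (1 + ‖ω‖ ^ 2) ^ β * ‖fourierReal f ω‖ ^ 2 := by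
  refine ⟨(continuous_weight.mul
    ((continuous_fourierReal hf.1).norm.pow 2)).aestronglyMeasurable, ?_⟩
  rw [hasFiniteIntegral_iff_ofReal (ae_of_all _ fun ω => by positivity)]
  exact hf.2.2.trans ENNReal.ofReal_lt_top

lemma integral_weighted_le_of_mem_sobolevBall {f : Rd d → ℝ} (hf : f ∈ sobolevBall d β M) :
    ∫ ω : Rd d, (1 + ‖ω‖ ^ 2) ^ β * ‖fourierReal f ω‖ ^ 2 ≤ M := by
  rw [integral_eq_lintegral_of_nonneg_ae (ae_of_all _ fun ω => by positivity)
    (integrable_weighted_of_mem_sobolevBall hf).aestronglyMeasurable]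
  exact ENNReal.toReal_le_of_le_ofReal (pos_of_mem_sobolevBall hf).le hf.2.2.le

lemma integrable_sq_of_integrable_weighted (hβ : 0 < β) {f : Rd d → ℝ} (hf : Integrable f)
    (hw : Integrable fun ω : Rd d => (1 + ‖ω‖ ^ 2) ^ β * ‖fourierReal f ω‖ ^ 2) :
    Integrable fun ω : Rd d => ‖fourierReal f ω‖ ^ 2 := by
  refine hw.mono ((continuous_fourierReal hf).norm.pow 2).aestronglyMeasurable
    (ae_of_all _ fun ω => ?_)
  rw [Real.norm_of_nonneg (by positivity), Real.norm_of_nonneg (by positivity)]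
  exact le_mul_of_one_le_left (sq_nonneg _) (one_le_weight hβ ω)

/-- Plancherel for integrable real functions with square integrable Fourier transform. -/
lemma lintegral_sq_eq_fourierReal {f : Rd d → ℝ} (hf : Integrable f)
    (hF : Integrable fun ω : Rd d => ‖fourierReal f ω‖ ^ 2) :
    ∫⁻ x, ENNReal.ofReal (f x ^ 2) = ENNReal.ofReal (∫ ω : Rd d, ‖fourierReal f ω‖ ^ 2) := by
  have hmem : MemLp (fourierReal f) 2 :=
    (memLp_two_iff_integrable_sq_norm (continuous_fourierReal hf).aestronglyMeasurable).2 hF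
  have hfC : Integrable fun x : Rd d => (f x : ℂ) := hf.ofReal
  have h := eLpNorm_two_eq_fourier hfC hmem
  rw [ofReal_integral_eq_lintegral_ofReal hF (ae_of_all _ fun ω => by positivity)]
  have h2 : ∀ F : Rd d → ℂ, eLpNorm F 2 volume ^ (2 : ℝ) = ∫⁻ x, ENNReal.ofReal (‖F x‖ ^ 2) := by
    intro F
    rw [eLpNorm_eq_lintegral_rpow_enorm_toReal two_ne_zero ENNReal.ofNat_ne_top,
      ← ENNReal.rpow_mul]
    simp only [ENNReal.toReal_ofNat, one_div, ne_eq, OfNat.ofNat_ne_zero, not_false_eq_true,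
      inv_mul_cancel₀, ENNReal.rpow_one, ENNReal.rpow_ofNat]
    refine lintegral_congr fun x => ?_
    rw [ENNReal.ofReal_pow (norm_nonneg _), ofReal_norm]
  have h3 := h2 (fun x => (f x : ℂ))
  rw [h, h2] at h3
  rw [fourierReal, h3]
  simp

/-- From `|a - b|² ≤ 2|a|² + 2|b|²`, which is where `4 M` comes from. -/
lemma sub_mem_fourier_bounds {p q : Rd d → ℝ} (hp : p ∈ sobolevBall d β M)
    (hq : q ∈ sobolevBall d β M) :
    Integrable (fun ω : Rd d => (1 + ‖ω‖ ^ 2) ^ β * ‖fourierReal (p - q) ω‖ ^ 2) ∧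
      ∫ ω : Rd d, (1 + ‖ω‖ ^ 2) ^ β * ‖fourierReal (p - q) ω‖ ^ 2 ≤ 4 * M := by
  have hle : ∀ ω : Rd d, (1 + ‖ω‖ ^ 2) ^ β * ‖fourierReal (p - q) ω‖ ^ 2
      ≤ 2 * ((1 + ‖ω‖ ^ 2) ^ β * ‖fourierReal p ω‖ ^ 2)
        + 2 * ((1 + ‖ω‖ ^ 2) ^ β * ‖fourierReal q ω‖ ^ 2) := by
    intro ω
    rw [fourierReal_sub hp.1 hq.1]
    have h1 := norm_sub_le (fourierReal p ω) (fourierReal q ω)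
    have h2 : ‖fourierReal p ω - fourierReal q ω‖ ^ 2
        ≤ 2 * ‖fourierReal p ω‖ ^ 2 + 2 * ‖fourierReal q ω‖ ^ 2 := by
      nlinarith [sq_nonneg (‖fourierReal p ω‖ - ‖fourierReal q ω‖),
        norm_nonneg (fourierReal p ω - fourierReal q ω)]
    have h3 : 0 ≤ (1 + ‖ω‖ ^ 2) ^ β := by positivity
    nlinarith [mul_le_mul_of_nonneg_left h2 h3]
  have hp' := integrable_weighted_of_mem_sobolevBall hp
  have hq' := integrable_weighted_of_mem_sobolevBall hq
  have hsum := (hp'.const_mul 2).add (hq'.const_mul 2)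
  have hint : Integrable
      (fun ω : Rd d => (1 + ‖ω‖ ^ 2) ^ β * ‖fourierReal (p - q) ω‖ ^ 2) := by
    refine hsum.mono' (continuous_weight.mul
      ((continuous_fourierReal (hp.1.sub hq.1)).norm.pow 2)).aestronglyMeasurable
      (ae_of_all _ fun ω => ?_)
    rw [Real.norm_of_nonneg (by positivity)]
    exact hle ω
  refine ⟨hint, (integral_mono hint hsum hle).trans ?_⟩
  simp only [Pi.add_apply]
  rw [integral_add (hp'.const_mul 2) (hq'.const_mul 2), integral_const_mul, integral_const_mul]
  linarith [integral_weighted_le_of_mem_sobolevBall hp, integral_weighted_le_of_mem_sobolevBall hq]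

/-- High frequencies carry little of the mass of a function with bounded Sobolev norm. -/
lemma le_integral_exp_mul_fourier (hβ : 0 < β) {g : Rd d → ℝ} (hg : Integrable g) {K s : ℝ}
    (hs : 0 < s)
    (hw : Integrable fun ω : Rd d => (1 + ‖ω‖ ^ 2) ^ β * ‖fourierReal g ω‖ ^ 2)
    (hK : ∫ ω : Rd d, (1 + ‖ω‖ ^ 2) ^ β * ‖fourierReal g ω‖ ^ 2 ≤ K) :
    Real.exp (-Real.pi ^ 2) * ((∫ ω : Rd d, ‖fourierReal g ω‖ ^ 2) - s ^ (-β) * K)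
      ≤ ∫ ω : Rd d, Real.exp (-(Real.pi ^ 2 / s) * ‖ω‖ ^ 2) * ‖fourierReal g ω‖ ^ 2 := by
  have h2 := integrable_sq_of_integrable_weighted hβ hg hw
  have hle : ∀ ω : Rd d, Real.exp (-Real.pi ^ 2) * (‖fourierReal g ω‖ ^ 2
      - s ^ (-β) * ((1 + ‖ω‖ ^ 2) ^ β * ‖fourierReal g ω‖ ^ 2))
      ≤ Real.exp (-(Real.pi ^ 2 / s) * ‖ω‖ ^ 2) * ‖fourierReal g ω‖ ^ 2 := by
    intro ω
    set x := ‖fourierReal g ω‖ ^ 2 with hx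
    have hx0 : 0 ≤ x := by positivity
    have hsβ : 0 < s ^ (-β) := Real.rpow_pos_of_pos hs _
    -- For `‖ω‖² ≤ s` the Gaussian weight is at least `exp(-π²)`. Beyond, `s^{-β} (1 + ‖ω‖²)^β ≥ 1`
    -- and the left side is nonpositive.
    rcases le_or_gt (‖ω‖ ^ 2) s with hω | hω
    · have h1 : Real.exp (-Real.pi ^ 2) ≤ Real.exp (-(Real.pi ^ 2 / s) * ‖ω‖ ^ 2) := by
        refine Real.exp_le_exp.2 ?_
        have : Real.pi ^ 2 / s * ‖ω‖ ^ 2 ≤ Real.pi ^ 2 / s * s := by gcongr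
        rw [div_mul_cancel₀ _ hs.ne'] at this
        linarith
      have h3 : 0 ≤ s ^ (-β) * ((1 + ‖ω‖ ^ 2) ^ β * x) := by positivity
      calc _ ≤ Real.exp (-Real.pi ^ 2) * x := by gcongr; linarith
        _ ≤ _ := by gcongr
    · have h1 : 1 ≤ s ^ (-β) * (1 + ‖ω‖ ^ 2) ^ β := by
        rw [Real.rpow_neg hs.le, ← div_eq_inv_mul, one_le_div (Real.rpow_pos_of_pos hs _)]
        exact Real.rpow_le_rpow hs.le (by linarith) hβ.le
      have h3 : x - s ^ (-β) * ((1 + ‖ω‖ ^ 2) ^ β * x) ≤ 0 := by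
        rw [← mul_assoc]
        nlinarith
      exact (mul_nonpos_of_nonneg_of_nonpos (Real.exp_pos _).le h3).trans (by positivity)
  have hleft := (h2.sub (hw.const_mul (s ^ (-β)))).const_mul (Real.exp (-Real.pi ^ 2))
  have hright : Integrable fun ω : Rd d =>
      Real.exp (-(Real.pi ^ 2 / s) * ‖ω‖ ^ 2) * ‖fourierReal g ω‖ ^ 2 := by
    refine h2.bdd_mul (c := 1) (Continuous.aestronglyMeasurable (by fun_prop))
      (ae_of_all _ fun ω => ?_)
    rw [Real.norm_of_nonneg (Real.exp_pos _).le, Real.exp_le_one_iff]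
    have : 0 ≤ Real.pi ^ 2 / s * ‖ω‖ ^ 2 := by positivity
    linarith
  refine le_trans ?_ (integral_mono hleft hright hle)
  simp only [Pi.sub_apply]
  rw [integral_const_mul, integral_sub h2 (hw.const_mul _), integral_const_mul]
  gcongr

end Sobolev

/-! ### Mass, Schur and supremum bounds for the kernel -/

section KernelBounds

variable {d : ℕ} {s : ℝ}

lemma gaussianKernel_nonneg (s : ℝ) (x y : Rd d) : 0 ≤ gaussianKernel s x y := (Real.exp_pos _).le

lemma gaussianKernel_le_one (hs : 0 < s) (x y : Rd d) : gaussianKernel s x y ≤ 1 := by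
  rw [gaussianKernel, Real.exp_le_one_iff]
  have : 0 ≤ s * ‖x - y‖ ^ 2 := by positivity
  linarith

lemma gaussianKernel_comm (s : ℝ) (x y : Rd d) : gaussianKernel s x y = gaussianKernel s y x := by
  rw [gaussianKernel, gaussianKernel, norm_sub_rev]

lemma continuous_gaussianKernel_uncurry (s : ℝ) :
    Continuous fun p : Rd d × Rd d => gaussianKernel s p.1 p.2 := by
  unfold gaussianKernel; fun_prop

@[fun_prop]
lemma measurable_gaussianKernel {Ω : Type*} [MeasurableSpace Ω] {s : ℝ} {f g : Ω → Rd d}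
    (hf : Measurable f) (hg : Measurable g) : Measurable fun ω => gaussianKernel s (f ω) (g ω) :=
  (continuous_gaussianKernel_uncurry s).measurable.comp (f := fun ω => (f ω, g ω)) (hf.prodMk hg)

/-- The total mass `(π / s)^{d/2}` of the Gaussian kernel. -/
noncomputable def kernelMass (d : ℕ) (s : ℝ) : ℝ := (Real.pi / s) ^ (d / 2 : ℝ)

lemma kernelMass_pos (hs : 0 < s) : 0 < kernelMass d s :=
  Real.rpow_pos_of_pos (by positivity) _

lemma integral_gaussianKernel (hs : 0 < s) (x : Rd d) :
    ∫ y, gaussianKernel s x y = kernelMass d s := by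
  have h := integral_sub_left_eq_self (fun v : Rd d => Real.exp (-s * ‖v‖ ^ 2)) volume x
  simp only [gaussianKernel]
  rw [h, GaussianFourier.integral_rexp_neg_mul_sq_norm hs, finrank_euclideanSpace_fin, kernelMass]

lemma integrable_gaussianKernel (hs : 0 < s) (x : Rd d) :
    Integrable fun y => gaussianKernel s x y := by
  -- A non-integrable function has integral `0` by convention, which contradicts the positive mass.
  by_contra h
  have := integral_undef h
  rw [integral_gaussianKernel hs] at this
  exact (kernelMass_pos hs).ne' this

lemma lintegral_gaussianKernel (hs : 0 < s) (x : Rd d) :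
    ∫⁻ y, ENNReal.ofReal (gaussianKernel s x y) = ENNReal.ofReal (kernelMass d s) := by
  rw [← integral_gaussianKernel hs x, ofReal_integral_eq_lintegral_ofReal
    (integrable_gaussianKernel hs x) (ae_of_all _ fun y => gaussianKernel_nonneg s x y)]

/-- Schur's test for the Gaussian kernel. -/
lemma lintegral_gaussianKernel_mul_le (hs : 0 < s) {f h : Rd d → ℝ} (hf : AEMeasurable f)
    (hh : AEMeasurable h) {a b : ℝ} (ha : 0 < a) (hb : 0 < b)
    (hfa : ∫⁻ x, ENNReal.ofReal (f x ^ 2) ≤ ENNReal.ofReal (a ^ 2))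
    (hhb : ∫⁻ x, ENNReal.ofReal (h x ^ 2) ≤ ENNReal.ofReal (b ^ 2)) :
    ∫⁻ x, ∫⁻ y, ENNReal.ofReal (gaussianKernel s x y * (f x * h y))
      ≤ ENNReal.ofReal (kernelMass d s * (a * b)) := by
  have hpt : ∀ x y, ENNReal.ofReal (gaussianKernel s x y * (f x * h y))
      ≤ ENNReal.ofReal (b / (2 * a)) * (ENNReal.ofReal (f x ^ 2)
          * ENNReal.ofReal (gaussianKernel s x y))
        + ENNReal.ofReal (a / (2 * b)) * (ENNReal.ofReal (h y ^ 2)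
          * ENNReal.ofReal (gaussianKernel s x y)) := by
    intro x y
    have hk := gaussianKernel_nonneg s x y
    rw [← ENNReal.ofReal_mul (by positivity), ← ENNReal.ofReal_mul (by positivity),
      ← ENNReal.ofReal_mul (by positivity), ← ENNReal.ofReal_mul (by positivity),
      ← ENNReal.ofReal_add (by positivity) (by positivity)]
    refine ENNReal.ofReal_le_ofReal ?_
    -- The weights balance the two squares: each contributes half of `kernelMass d s * (a * b)`.
    have h1 : f x * h y ≤ b / (2 * a) * f x ^ 2 + a / (2 * b) * h y ^ 2 := by
      have : b / (2 * a) * f x ^ 2 + a / (2 * b) * h y ^ 2 - f x * h y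
          = (b * f x - a * h y) ^ 2 / (2 * a * b) := by
        field_simp
        ring
      have h2 : 0 ≤ (b * f x - a * h y) ^ 2 / (2 * a * b) := by positivity
      linarith
    calc _ ≤ gaussianKernel s x y * (b / (2 * a) * f x ^ 2 + a / (2 * b) * h y ^ 2) := by gcongr
      _ = _ := by ring
  have hk1 : ∀ x : Rd d, Measurable fun y => ENNReal.ofReal (gaussianKernel s x y) :=
    fun x => by fun_prop
  have hswap : ∫⁻ x, ∫⁻ y, ENNReal.ofReal (h y ^ 2) * ENNReal.ofReal (gaussianKernel s x y)
      = ∫⁻ y, ∫⁻ x, ENNReal.ofReal (h y ^ 2) * ENNReal.ofReal (gaussianKernel s x y) := by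
    refine lintegral_lintegral_swap ?_
    have h1 : AEMeasurable (fun z : Rd d × Rd d => ENNReal.ofReal (h z.2 ^ 2))
        (volume.prod volume) := ((hh.comp_snd (μ := volume)).pow_const 2).ennreal_ofReal
    have h2 : AEMeasurable (fun z : Rd d × Rd d => ENNReal.ofReal (gaussianKernel s z.1 z.2))
        (volume.prod volume) := Measurable.aemeasurable (by fun_prop)
    exact h1.mul h2
  calc _ ≤ ∫⁻ x, ∫⁻ y, (ENNReal.ofReal (b / (2 * a)) * (ENNReal.ofReal (f x ^ 2)
          * ENNReal.ofReal (gaussianKernel s x y))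
        + ENNReal.ofReal (a / (2 * b)) * (ENNReal.ofReal (h y ^ 2)
          * ENNReal.ofReal (gaussianKernel s x y))) :=
        lintegral_mono fun x => lintegral_mono fun y => hpt x y
    _ = ENNReal.ofReal (b / (2 * a)) * (∫⁻ x, ∫⁻ y, ENNReal.ofReal (f x ^ 2)
          * ENNReal.ofReal (gaussianKernel s x y))
        + ENNReal.ofReal (a / (2 * b)) * ∫⁻ x, ∫⁻ y, (ENNReal.ofReal (h y ^ 2)
          * ENNReal.ofReal (gaussianKernel s x y)) := by
        have e1 : ∀ x, ∫⁻ y, (ENNReal.ofReal (b / (2 * a)) * (ENNReal.ofReal (f x ^ 2)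
            * ENNReal.ofReal (gaussianKernel s x y))
            + ENNReal.ofReal (a / (2 * b)) * (ENNReal.ofReal (h y ^ 2)
              * ENNReal.ofReal (gaussianKernel s x y)))
            = ENNReal.ofReal (b / (2 * a)) * (∫⁻ y, ENNReal.ofReal (f x ^ 2)
              * ENNReal.ofReal (gaussianKernel s x y))
            + ENNReal.ofReal (a / (2 * b)) * ∫⁻ y, (ENNReal.ofReal (h y ^ 2)
              * ENNReal.ofReal (gaussianKernel s x y)) := by
          intro x
          rw [lintegral_add_left (((hk1 x).const_mul _).const_mul _)]
          simp only [lintegral_const_mul' _ _ ENNReal.ofReal_ne_top]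
        simp only [e1]
        rw [lintegral_add_left', lintegral_const_mul' _ _ ENNReal.ofReal_ne_top,
          lintegral_const_mul' _ _ ENNReal.ofReal_ne_top]
        simp only [lintegral_const_mul' _ _ ENNReal.ofReal_ne_top, lintegral_gaussianKernel hs]
        fun_prop
    _ ≤ ENNReal.ofReal (b / (2 * a)) * (ENNReal.ofReal (a ^ 2) * ENNReal.ofReal (kernelMass d s))
        + ENNReal.ofReal (a / (2 * b))
          * (ENNReal.ofReal (b ^ 2) * ENNReal.ofReal (kernelMass d s)) := by
        rw [hswap]
        have e2 : ∀ y : Rd d, ∫⁻ x, ENNReal.ofReal (gaussianKernel s x y)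
            = ENNReal.ofReal (kernelMass d s) := fun y => by
          simp only [fun x => gaussianKernel_comm s x y]
          exact lintegral_gaussianKernel hs y
        simp only [lintegral_const_mul' _ _ ENNReal.ofReal_ne_top, lintegral_gaussianKernel hs, e2]
        rw [lintegral_mul_const' _ _ ENNReal.ofReal_ne_top,
          lintegral_mul_const' _ _ ENNReal.ofReal_ne_top]
        gcongr
    _ = ENNReal.ofReal (kernelMass d s * (a * b)) := by
        have hc := (kernelMass_pos (d := d) hs).le
        rw [← ENNReal.ofReal_mul (by positivity), ← ENNReal.ofReal_mul (by positivity),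
          ← ENNReal.ofReal_mul (by positivity), ← ENNReal.ofReal_mul (by positivity),
          ← ENNReal.ofReal_add (by positivity) (by positivity)]
        congr 1
        field_simp
        ring

/-- The Gaussian smoothing of a square integrable function is bounded. -/
lemma abs_integral_gaussianKernel_mul_le (hs : 0 < s) {g : Rd d → ℝ} (hg : Integrable g)
    {D : ℝ} (hD : 0 < D) (hgD : ∫⁻ x, ENNReal.ofReal (g x ^ 2) ≤ ENNReal.ofReal (D ^ 2))
    (x : Rd d) : |∫ y, gaussianKernel s x y * g y| ≤ √(kernelMass d s) * D := by
  set c := kernelMass d s with hc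
  have hc0 : 0 < c := kernelMass_pos hs
  have hsq : Integrable fun y => g y ^ 2 :=
    ⟨hg.aestronglyMeasurable.pow 2, by
      rw [hasFiniteIntegral_iff_ofReal (ae_of_all _ fun _ => sq_nonneg _)]
      exact hgD.trans_lt ENNReal.ofReal_lt_top⟩
  have hint : ∫ y, g y ^ 2 ≤ D ^ 2 := by
    rw [integral_eq_lintegral_of_nonneg_ae (ae_of_all _ fun _ => sq_nonneg _)
      hsq.aestronglyMeasurable]
    exact ENNReal.toReal_le_of_le_ofReal (sq_nonneg _) hgD
  have hk := integrable_gaussianKernel hs x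
  -- The minimizer of `t c / 2 + D² / (2 t)`. This is Cauchy–Schwarz in additive form, combined with
  -- `k² ≤ k` from `0 ≤ k ≤ 1`.
  set t := D / √c with ht
  have ht0 : 0 < t := by positivity
  have hle : ∀ y, ‖gaussianKernel s x y * g y‖
      ≤ t / 2 * gaussianKernel s x y + 1 / (2 * t) * g y ^ 2 := by
    intro y
    have k0 := gaussianKernel_nonneg s x y
    have k1 := gaussianKernel_le_one hs x y
    rw [norm_mul, Real.norm_of_nonneg k0, Real.norm_eq_abs]
    have h1 : t / 2 * gaussianKernel s x y ^ 2 + 1 / (2 * t) * |g y| ^ 2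
        - gaussianKernel s x y * |g y| = (t * gaussianKernel s x y - |g y|) ^ 2 / (2 * t) := by
      field_simp
      ring
    have h2 : 0 ≤ (t * gaussianKernel s x y - |g y|) ^ 2 / (2 * t) := by positivity
    have h3 : t / 2 * gaussianKernel s x y ^ 2 ≤ t / 2 * gaussianKernel s x y := by
      gcongr
      nlinarith
    rw [sq_abs] at h1
    linarith
  have hR := (hk.const_mul (t / 2)).add (hsq.const_mul (1 / (2 * t)))
  calc |∫ y, gaussianKernel s x y * g y|
      ≤ ∫ y, (t / 2 * gaussianKernel s x y + 1 / (2 * t) * g y ^ 2) :=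
        norm_integral_le_of_norm_le hR (ae_of_all _ hle)
    _ = t / 2 * c + 1 / (2 * t) * ∫ y, g y ^ 2 := by
        rw [integral_add (hk.const_mul _) (hsq.const_mul _), integral_const_mul,
          integral_const_mul, integral_gaussianKernel hs]
    _ ≤ t / 2 * c + 1 / (2 * t) * D ^ 2 := by gcongr
    _ = √c * D := by
        have : √c ^ 2 = c := Real.sq_sqrt hc0.le
        have h0 : √c ≠ 0 := by positivity
        rw [ht]
        field_simp
        rw [this]
        ring

end KernelBounds

/-! ### Signal and second moments for smooth densities -/

section Densities

variable {d : ℕ} {s β M : ℝ}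

/-- The population witness function `y ↦ ∫ k(y, x) dP(x) - ∫ k(y, x) dQ(x)`. -/
noncomputable def meanWitness (k : Rd d → Rd d → ℝ) (P Q : Measure (Rd d)) (y : Rd d) : ℝ :=
  ∫ x, k y x ∂P - ∫ x, k y x ∂Q

/-- The squared maximum mean discrepancy. -/
noncomputable def mmdSq (k : Rd d → Rd d → ℝ) (P Q : Measure (Rd d)) : ℝ :=
  ∫ y, meanWitness k P Q y ∂P - ∫ y, meanWitness k P Q y ∂Q

lemma measurable_meanWitness (s : ℝ) (P Q : Measure (Rd d)) [SFinite P] [SFinite Q] :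
    Measurable (meanWitness (gaussianKernel s) P Q) := by
  have h : StronglyMeasurable (Function.uncurry (gaussianKernel (d := d) s)) :=
    (continuous_gaussianKernel_uncurry s).stronglyMeasurable
  exact (h.integral_prod_right (ν := P)).measurable.sub (h.integral_prod_right (ν := Q)).measurable

/-- The measure with density `p`. -/
noncomputable def densityMeasure (p : Rd d → ℝ) : Measure (Rd d) :=
  volume.withDensity fun x => ENNReal.ofReal (p x)

lemma integral_densityMeasure {p : Rd d → ℝ} (hp : AEMeasurable p) (hp0 : ∀ x, 0 ≤ p x)
    (F : Rd d → ℝ) : ∫ x, F x ∂(densityMeasure p) = ∫ x, p x * F x := by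
  rw [densityMeasure, integral_withDensity_eq_integral_toReal_smul₀ hp.ennreal_ofReal
    (ae_of_all _ fun _ => ENNReal.ofReal_lt_top)]
  simp only [ENNReal.toReal_ofReal (hp0 _), smul_eq_mul]

lemma lintegral_densityMeasure {p : Rd d → ℝ} (hp : AEMeasurable p)
    {F : Rd d → ℝ≥0∞} (hF : Measurable F) :
    ∫⁻ x, F x ∂(densityMeasure p) = ∫⁻ x, ENNReal.ofReal (p x) * F x := by
  rw [densityMeasure, lintegral_withDensity_eq_lintegral_mul₀ hp.ennreal_ofReal hF.aemeasurable]
  rfl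

lemma integrable_mul_gaussianKernel (hs : 0 < s) {p : Rd d → ℝ} (hp : Integrable p) (y : Rd d) :
    Integrable fun x => p x * gaussianKernel s y x :=
  hp.mul_bdd (c := 1) (Measurable.aestronglyMeasurable (by fun_prop)) (ae_of_all _ fun x => by
    rw [Real.norm_of_nonneg (gaussianKernel_nonneg s y x)]; exact gaussianKernel_le_one hs y x)

lemma meanWitness_densityMeasure (hs : 0 < s) {p q : Rd d → ℝ} (hp : Integrable p)
    (hq : Integrable q) (hp0 : ∀ x, 0 ≤ p x) (hq0 : ∀ x, 0 ≤ q x) (y : Rd d) :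
    meanWitness (gaussianKernel s) (densityMeasure p) (densityMeasure q) y
      = ∫ x, gaussianKernel s y x * (p - q) x := by
  rw [meanWitness, integral_densityMeasure hp.aemeasurable hp0,
    integral_densityMeasure hq.aemeasurable hq0, ← integral_sub
      (integrable_mul_gaussianKernel hs hp y) (integrable_mul_gaussianKernel hs hq y)]
  refine integral_congr_ae (ae_of_all _ fun x => ?_)
  simp only [Pi.sub_apply]
  ring

/-- Plancherel and the fact that the Sobolev weight is at least one. This is the `L²` input of
Schur's test. -/
lemma lintegral_sq_le_of_mem_sobolevBall (hβ : 0 < β) {p : Rd d → ℝ} (hp : p ∈ sobolevBall d β M) :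
    ∫⁻ x, ENNReal.ofReal (p x ^ 2) ≤ ENNReal.ofReal (√M ^ 2) := by
  have hw := integrable_weighted_of_mem_sobolevBall hp
  have h2 := integrable_sq_of_integrable_weighted hβ hp.1 hw
  rw [lintegral_sq_eq_fourierReal hp.1 h2, Real.sq_sqrt (pos_of_mem_sobolevBall hp).le]
  refine ENNReal.ofReal_le_ofReal ((integral_mono h2 hw fun ω => ?_).trans
    (integral_weighted_le_of_mem_sobolevBall hp))
  exact le_mul_of_one_le_left (sq_nonneg _) (one_le_weight hβ ω)

/-- The second moment of the population witness function under a law with smooth density. -/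
lemma lintegral_meanWitness_sq_le (hs : 0 < s) (hβ : 0 < β) {p q r : Rd d → ℝ}
    (hp : p ∈ sobolevBall d β M) (hq : q ∈ sobolevBall d β M) (hr : r ∈ sobolevBall d β M)
    (hp0 : ∀ x, 0 ≤ p x) (hq0 : ∀ x, 0 ≤ q x) (hr0 : ∀ x, 0 ≤ r x) {D : ℝ} (hD : 0 < D)
    (hgD : ∫⁻ x, ENNReal.ofReal ((p - q) x ^ 2) ≤ ENNReal.ofReal (D ^ 2))
    [SFinite (densityMeasure p)] [SFinite (densityMeasure q)] :
    ∫⁻ y, ENNReal.ofReal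
        (meanWitness (gaussianKernel s) (densityMeasure p) (densityMeasure q) y ^ 2)
        ∂(densityMeasure r)
      ≤ ENNReal.ofReal (√(kernelMass d s) * kernelMass d s * √M * D ^ 2) := by
  have hM := pos_of_mem_sobolevBall hp
  have hg : Integrable (p - q) := hp.1.sub hq.1
  set c := kernelMass d s with hc
  have hc0 : 0 < c := kernelMass_pos hs
  have hmeas := measurable_meanWitness s (densityMeasure p) (densityMeasure q)
  rw [lintegral_densityMeasure hr.1.aemeasurable (by fun_prop)]
  have hsup : ∀ y, |meanWitness (gaussianKernel s) (densityMeasure p) (densityMeasure q) y|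
      ≤ √c * D := fun y => by
    rw [meanWitness_densityMeasure hs hp.1 hq.1 hp0 hq0]
    exact abs_integral_gaussianKernel_mul_le hs hg hD hgD y
  have hl1 : ∀ y, ENNReal.ofReal
      |meanWitness (gaussianKernel s) (densityMeasure p) (densityMeasure q) y|
      ≤ ∫⁻ x, ENNReal.ofReal (gaussianKernel s y x * |(p - q) x|) := fun y => by
    rw [meanWitness_densityMeasure hs hp.1 hq.1 hp0 hq0, ← Real.norm_eq_abs, ofReal_norm]
    refine (enorm_integral_le_lintegral_enorm _).trans (lintegral_mono fun x => ?_)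
    rw [← ofReal_norm, norm_mul, Real.norm_of_nonneg (gaussianKernel_nonneg s y x),
      Real.norm_eq_abs]
  -- One factor of the square is bounded by its supremum `√c D`, the other is integrated against `r`
  -- by Schur's test. Using the supremum twice would lose a factor `√c`, which matters because `c`
  -- tends to `0`.
  calc _ ≤ ∫⁻ y, ENNReal.ofReal (√c * D) * ∫⁻ x,
        ENNReal.ofReal (gaussianKernel s y x * (r y * |(p - q) x|)) := by
        refine lintegral_mono fun y => ?_
        have h1 : ∫⁻ x, ENNReal.ofReal (gaussianKernel s y x * (r y * |(p - q) x|))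
            = ENNReal.ofReal (r y) * ∫⁻ x, ENNReal.ofReal (gaussianKernel s y x * |(p - q) x|) := by
          rw [← lintegral_const_mul' _ _ ENNReal.ofReal_ne_top]
          refine lintegral_congr fun x => ?_
          rw [← ENNReal.ofReal_mul (hr0 y)]
          congr 1
          ring
        rw [h1, mul_left_comm]
        gcongr
        rw [← sq_abs, sq, ENNReal.ofReal_mul (abs_nonneg _)]
        gcongr
        · exact hsup y
        · exact hl1 y
    _ ≤ ENNReal.ofReal (√c * D) * ENNReal.ofReal (c * (√M * D)) := by
        rw [lintegral_const_mul' _ _ ENNReal.ofReal_ne_top]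
        gcongr
        refine lintegral_gaussianKernel_mul_le hs (f := r) (h := fun x => |(p - q) x|)
          hr.1.aemeasurable hg.abs.aemeasurable
          (Real.sqrt_pos.2 hM) hD (lintegral_sq_le_of_mem_sobolevBall hβ hr) ?_
        simpa only [sq_abs] using hgD
    _ = _ := by
        rw [← ENNReal.ofReal_mul (by positivity)]
        congr 1
        ring

/-- The second moment of the Gaussian kernel under laws with smooth densities. -/
lemma lintegral_gaussianKernel_sq_le (hs : 0 < s) (hβ : 0 < β) {p q : Rd d → ℝ}
    (hp : p ∈ sobolevBall d β M) (hq : q ∈ sobolevBall d β M) (hp0 : ∀ x, 0 ≤ p x)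
    [SFinite (densityMeasure q)] :
    ∫⁻ x, ∫⁻ y, ENNReal.ofReal (gaussianKernel s x y ^ 2) ∂(densityMeasure q) ∂(densityMeasure p)
      ≤ ENNReal.ofReal (kernelMass d s * M) := by
  have hM := pos_of_mem_sobolevBall hp
  have hmeas : Measurable fun x : Rd d =>
      ∫⁻ y, ENNReal.ofReal (gaussianKernel s x y ^ 2) ∂(densityMeasure q) := by
    have : Measurable fun z : Rd d × Rd d => ENNReal.ofReal (gaussianKernel s z.1 z.2 ^ 2) := by
      fun_prop
    exact this.lintegral_prod_right'
  rw [lintegral_densityMeasure hp.1.aemeasurable hmeas]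
  -- As `0 ≤ k ≤ 1`, the square of the kernel is at most the kernel, and Schur's test applies to the
  -- two densities.
  calc _ ≤ ∫⁻ x, ∫⁻ y, ENNReal.ofReal (gaussianKernel s x y * (p x * q y)) := by
        refine lintegral_mono fun x => ?_
        rw [lintegral_densityMeasure hq.1.aemeasurable (by fun_prop),
          ← lintegral_const_mul' _ _ ENNReal.ofReal_ne_top]
        refine lintegral_mono fun y => ?_
        have k0 := gaussianKernel_nonneg s x y
        have k1 := gaussianKernel_le_one hs x y
        rw [ENNReal.ofReal_mul k0, ENNReal.ofReal_mul (hp0 x)]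
        calc _ = ENNReal.ofReal (gaussianKernel s x y ^ 2)
              * (ENNReal.ofReal (p x) * ENNReal.ofReal (q y)) := by ring
          _ ≤ _ := by gcongr; nlinarith
    _ ≤ ENNReal.ofReal (kernelMass d s * (√M * √M)) :=
        lintegral_gaussianKernel_mul_le hs hp.1.aemeasurable hq.1.aemeasurable
          (Real.sqrt_pos.2 hM) (Real.sqrt_pos.2 hM) (lintegral_sq_le_of_mem_sobolevBall hβ hp)
          (lintegral_sq_le_of_mem_sobolevBall hβ hq)
    _ = _ := by rw [Real.mul_self_sqrt hM.le]

/-- A lower bound for the squared maximum mean discrepancy of laws with smooth densities. -/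
lemma le_mmdSq (hs : 0 < s) (hβ : 0 < β) {p q : Rd d → ℝ}
    (hp : p ∈ sobolevBall d β M) (hq : q ∈ sobolevBall d β M)
    (hp0 : ∀ x, 0 ≤ p x) (hq0 : ∀ x, 0 ≤ q x)
    [IsFiniteMeasure (densityMeasure p)] [IsFiniteMeasure (densityMeasure q)] :
    kernelMass d s * (Real.exp (-Real.pi ^ 2) *
      ((∫ ω : Rd d, ‖fourierReal (p - q) ω‖ ^ 2) - s ^ (-β) * (4 * M)))
      ≤ mmdSq (gaussianKernel s) (densityMeasure p) (densityMeasure q) := by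
  have hg : Integrable (p - q) := hp.1.sub hq.1
  obtain ⟨hw, hK⟩ := sub_mem_fourier_bounds hp hq
  have h1 := le_integral_exp_mul_fourier hβ hg hs hw hK
  -- By bilinearity the discrepancy is the Gaussian energy of `p - q`; boundedness of the population
  -- witness justifies the subtraction of integrals.
  have h2 : mmdSq (gaussianKernel s) (densityMeasure p) (densityMeasure q)
      = ∫ x, (p - q) x * ∫ y, gaussianKernel s x y * (p - q) y := by
    have hmeas := measurable_meanWitness s (densityMeasure p) (densityMeasure q)
    have hbdd : ∀ y, ‖meanWitness (gaussianKernel s) (densityMeasure p) (densityMeasure q) y‖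
        ≤ ∫ x, ‖(p - q) x‖ := fun y => by
      rw [meanWitness_densityMeasure hs hp.1 hq.1 hp0 hq0]
      refine norm_integral_le_of_norm_le hg.norm (ae_of_all _ fun x => ?_)
      rw [norm_mul, Real.norm_of_nonneg (gaussianKernel_nonneg s y x)]
      exact mul_le_of_le_one_left (norm_nonneg _) (gaussianKernel_le_one hs y x)
    rw [mmdSq, integral_densityMeasure hp.1.aemeasurable hp0,
      integral_densityMeasure hq.1.aemeasurable hq0, ← integral_sub
      (hp.1.mul_bdd hmeas.aestronglyMeasurable (ae_of_all _ hbdd))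
      (hq.1.mul_bdd hmeas.aestronglyMeasurable (ae_of_all _ hbdd))]
    refine integral_congr_ae (ae_of_all _ fun x => ?_)
    simp only [meanWitness_densityMeasure hs hp.1 hq.1 hp0 hq0, Pi.sub_apply]
    ring
  rw [h2, integral_gaussianKernel_mul_mul hs hg]
  exact mul_le_mul_of_nonneg_left h1 (kernelMass_pos hs).le

end Densities

/-! ### Fluctuations of the estimated witness function -/

section WitnessMoments

variable {d n : ℕ} {s : ℝ}

lemma memLp_gaussianKernel_left (hs : 0 < s) (P : Measure (Rd d)) [IsFiniteMeasure P] (x : Rd d) :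
    MemLp (fun y => gaussianKernel s x y) 2 P :=
  MemLp.of_bound (Measurable.aestronglyMeasurable (by fun_prop)) 1 (ae_of_all _ fun y => by
    rw [Real.norm_of_nonneg (gaussianKernel_nonneg s x y)]; exact gaussianKernel_le_one hs x y)

lemma memLp_gaussianKernel_right (hs : 0 < s) (P : Measure (Rd d)) [IsFiniteMeasure P] (x : Rd d) :
    MemLp (fun y => gaussianKernel s y x) 2 P := by
  simpa only [gaussianKernel_comm s x] using memLp_gaussianKernel_left hs P x

lemma abs_meanWitness_le (hs : 0 < s) (P Q : Measure (Rd d)) [IsProbabilityMeasure P]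
    [IsProbabilityMeasure Q] (y : Rd d) : ‖meanWitness (gaussianKernel s) P Q y‖ ≤ 2 := by
  have h : ∀ ν : Measure (Rd d), IsProbabilityMeasure ν →
      ‖∫ x, gaussianKernel s y x ∂ν‖ ≤ 1 := fun ν _ => by
    have h := norm_integral_le_of_norm_le_const (μ := ν) (C := 1)
      (f := fun x => gaussianKernel s y x) (ae_of_all _ fun x => by
        rw [Real.norm_of_nonneg (gaussianKernel_nonneg s y x)]
        exact gaussianKernel_le_one hs y x)
    rwa [probReal_univ, mul_one] at h
  calc _ ≤ _ := norm_sub_le _ _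
    _ ≤ 1 + 1 := add_le_add (h P inferInstance) (h Q inferInstance)
    _ = 2 := by norm_num

lemma memLp_meanWitness (hs : 0 < s) (P Q ν : Measure (Rd d)) [IsProbabilityMeasure P]
    [IsProbabilityMeasure Q] [IsProbabilityMeasure ν] :
    MemLp (meanWitness (gaussianKernel s) P Q) 2 ν :=
  MemLp.of_bound (measurable_meanWitness s P Q).aestronglyMeasurable 2
    (ae_of_all _ (abs_meanWitness_le hs P Q))

/-- Mean squared error of the difference of two sample means. -/
lemma lintegral_sq_two_sample_le {Ω : Type*} [MeasurableSpace Ω] (hn : 1 ≤ n) {P Q : Measure Ω}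
    [IsProbabilityMeasure P] [IsProbabilityMeasure Q] {b : Ω → ℝ} (hbm : Measurable b)
    (hP : MemLp b 2 P) (hQ : MemLp b 2 Q) :
    ∫⁻ w : (Fin n → Ω) × (Fin n → Ω), ENNReal.ofReal
        (((1 / (n : ℝ)) * ∑ i, b (w.1 i) - (1 / (n : ℝ)) * ∑ i, b (w.2 i)
          - (∫ y, b y ∂P - ∫ y, b y ∂Q)) ^ 2)
        ∂((Measure.pi fun _ => P).prod (Measure.pi fun _ => Q))
      ≤ ENNReal.ofReal (2 / n) * (∫⁻ y, ENNReal.ofReal (b y ^ 2) ∂P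
          + ∫⁻ y, ENNReal.ofReal (b y ^ 2) ∂Q) := by
  have hn0 : (0 : ℝ) < n := by exact_mod_cast hn
  have hone : ∀ ν : Measure Ω, IsProbabilityMeasure ν → MemLp b 2 ν →
      ∫⁻ x : Fin n → Ω, ENNReal.ofReal (((1 / (n : ℝ)) * ∑ i, (b (x i) - ∫ y, b y ∂ν)) ^ 2)
        ∂(Measure.pi fun _ => ν)
        ≤ ENNReal.ofReal (1 / n) * ∫⁻ y, ENNReal.ofReal (b y ^ 2) ∂ν := by
    intro ν _ hR
    rw [lintegral_ofReal_mul_sq]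
    have h1 := lintegral_sq_sum_sub_le (ι := Fin n) hR 0
    simp only [sub_zero, Fintype.card_fin] at h1
    calc _ ≤ ENNReal.ofReal ((1 / (n : ℝ)) ^ 2) * (n * ∫⁻ y, ENNReal.ofReal (b y ^ 2) ∂ν) := by
          gcongr
      _ = _ := by
          rw [← mul_assoc, ← ENNReal.ofReal_natCast, ← ENNReal.ofReal_mul (by positivity)]
          congr 2
          field_simp
  calc _ ≤ ∫⁻ w : (Fin n → Ω) × (Fin n → Ω),
        (2 * ENNReal.ofReal (((1 / (n : ℝ)) * ∑ i, (b (w.1 i) - ∫ y, b y ∂P)) ^ 2)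
        + 2 * ENNReal.ofReal (((1 / (n : ℝ)) * ∑ i, (b (w.2 i) - ∫ y, b y ∂Q)) ^ 2))
        ∂((Measure.pi fun _ => P).prod (Measure.pi fun _ => Q)) := by
        refine lintegral_mono fun w => ?_
        have h := ofReal_sq_add_le ((1 / (n : ℝ)) * ∑ i, (b (w.1 i) - ∫ y, b y ∂P))
          (-((1 / (n : ℝ)) * ∑ i, (b (w.2 i) - ∫ y, b y ∂Q)))
        rw [neg_sq] at h
        refine le_trans (le_of_eq ?_) h
        congr 2
        simp only [Finset.sum_sub_distrib, Finset.sum_const, Finset.card_univ, Fintype.card_fin,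
          nsmul_eq_mul]
        field_simp
        ring
    _ ≤ 2 * (ENNReal.ofReal (1 / n) * ∫⁻ y, ENNReal.ofReal (b y ^ 2) ∂P)
        + 2 * (ENNReal.ofReal (1 / n) * ∫⁻ y, ENNReal.ofReal (b y ^ 2) ∂Q) := by
        rw [lintegral_add_left (by fun_prop), lintegral_const_mul' _ _ ENNReal.ofNat_ne_top,
          lintegral_const_mul' _ _ ENNReal.ofNat_ne_top]
        have h1 := (measurePreserving_fst (μ := Measure.pi fun _ : Fin n => P)
          (ν := Measure.pi fun _ : Fin n => Q)).lintegral_comp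
          (f := fun x => ENNReal.ofReal (((1 / (n : ℝ)) * ∑ i, (b (x i) - ∫ y, b y ∂P)) ^ 2))
          (by fun_prop)
        have h2 := (measurePreserving_snd (μ := Measure.pi fun _ : Fin n => P)
          (ν := Measure.pi fun _ : Fin n => Q)).lintegral_comp
          (f := fun x => ENNReal.ofReal (((1 / (n : ℝ)) * ∑ i, (b (x i) - ∫ y, b y ∂Q)) ^ 2))
          (by fun_prop)
        rw [h1, h2]
        gcongr
        · exact hone P inferInstance hP
        · exact hone Q inferInstance hQ
    _ = _ := by
        rw [show (2 / n : ℝ) = 2 * (1 / n) by ring, ENNReal.ofReal_mul zero_le_two,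
          ENNReal.ofReal_ofNat]
        ring

@[fun_prop]
lemma measurable_witness {Ω : Type*} [MeasurableSpace Ω] {n₁ n₂ : ℕ} {F : Ω → Fin n₁ → Rd d}
    {G : Ω → Fin n₂ → Rd d} {H : Ω → Rd d} (hF : Measurable F) (hG : Measurable G)
    (hH : Measurable H) :
    Measurable fun ω => witness (gaussianKernel s) (F ω) (G ω) (H ω) := by
  unfold witness
  have h1 : ∀ i, Measurable fun ω => F ω i := fun i => (measurable_pi_apply i).comp hF
  have h2 : ∀ i, Measurable fun ω => G ω i := fun i => (measurable_pi_apply i).comp hG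
  fun_prop

lemma memLp_witness (hs : 0 < s) {n₁ n₂ : ℕ} (xt : Fin n₁ → Rd d) (yt : Fin n₂ → Rd d)
    (ν : Measure (Rd d)) [IsFiniteMeasure ν] : MemLp (witness (gaussianKernel s) xt yt) 2 ν :=
  ((memLp_finsetSum _ fun i _ => memLp_gaussianKernel_left hs ν (xt i)).const_mul _).sub
    ((memLp_finsetSum _ fun i _ => memLp_gaussianKernel_left hs ν (yt i)).const_mul _)

variable (P Q : Measure (Rd d)) [IsProbabilityMeasure P] [IsProbabilityMeasure Q]

/-- Linearity of the witness in its sample points. It turns the conditional signal into a difference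
of two sample means, whose expectation is `mmdSq`. -/
lemma integral_witness_sub (hs : 0 < s) {n₁ n₂ : ℕ} (xt : Fin n₁ → Rd d) (yt : Fin n₂ → Rd d) :
    ∫ x, witness (gaussianKernel s) xt yt x ∂P - ∫ x, witness (gaussianKernel s) xt yt x ∂Q
      = (1 / (n₁ : ℝ)) * ∑ i, meanWitness (gaussianKernel s) P Q (xt i)
        - (1 / (n₂ : ℝ)) * ∑ i, meanWitness (gaussianKernel s) P Q (yt i) := by
  have h : ∀ ν : Measure (Rd d), IsProbabilityMeasure ν →
      ∫ x, witness (gaussianKernel s) xt yt x ∂ν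
        = (1 / (n₁ : ℝ)) * ∑ i, ∫ x, gaussianKernel s (xt i) x ∂ν
          - (1 / (n₂ : ℝ)) * ∑ i, ∫ x, gaussianKernel s (yt i) x ∂ν := by
    intro ν _
    have hi : ∀ y, Integrable (fun x => gaussianKernel s y x) ν := fun y =>
      (memLp_gaussianKernel_left hs ν y).integrable one_le_two
    simp only [witness]
    rw [integral_sub ((integrable_finsetSum _ fun i _ => hi _).const_mul _)
      ((integrable_finsetSum _ fun i _ => hi _).const_mul _), integral_const_mul,
      integral_const_mul, integral_finsetSum _ fun i _ => hi _,
      integral_finsetSum _ fun i _ => hi _]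
  rw [h P inferInstance, h Q inferInstance]
  simp only [meanWitness, Finset.sum_sub_distrib]
  ring

/-- The estimated squared discrepancy concentrates around its mean. -/
lemma lintegral_witness_sub_mmdSq_le (hs : 0 < s) (hn : 1 ≤ n) {A : ℝ} (hA : 0 ≤ A)
    (hAP : ∫⁻ y, ENNReal.ofReal (meanWitness (gaussianKernel s) P Q y ^ 2) ∂P ≤ ENNReal.ofReal A)
    (hAQ : ∫⁻ y, ENNReal.ofReal (meanWitness (gaussianKernel s) P Q y ^ 2) ∂Q
      ≤ ENNReal.ofReal A) :
    ∫⁻ w : (Fin n → Rd d) × (Fin n → Rd d), ENNReal.ofReal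
        ((∫ x, witness (gaussianKernel s) w.1 w.2 x ∂P
          - ∫ x, witness (gaussianKernel s) w.1 w.2 x ∂Q - mmdSq (gaussianKernel s) P Q) ^ 2)
        ∂((Measure.pi fun _ => P).prod (Measure.pi fun _ => Q))
      ≤ ENNReal.ofReal (4 * A / n) := by
  simp only [integral_witness_sub P Q hs, mmdSq]
  refine (lintegral_sq_two_sample_le hn (measurable_meanWitness s P Q)
    (memLp_meanWitness hs P Q P) (memLp_meanWitness hs P Q Q)).trans ?_
  calc _ ≤ ENNReal.ofReal (2 / n) * (ENNReal.ofReal A + ENNReal.ofReal A) := by gcongr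
    _ = _ := by
      rw [← ENNReal.ofReal_add hA hA, ← ENNReal.ofReal_mul (by positivity)]
      congr 1
      ring

/-- The mean of the conditional variance of the estimated witness function. -/
lemma lintegral_evariance_witness_le (hs : 0 < s) (hn : 1 ≤ n) (ν : Measure (Rd d))
    [IsProbabilityMeasure ν] {A B : ℝ} (hA : 0 ≤ A) (hB : 0 ≤ B)
    (hAR : ∫⁻ y, ENNReal.ofReal (meanWitness (gaussianKernel s) P Q y ^ 2) ∂ν ≤ ENNReal.ofReal A)
    (hBP : ∫⁻ x, ∫⁻ y, ENNReal.ofReal (gaussianKernel s x y ^ 2) ∂P ∂ν ≤ ENNReal.ofReal B)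
    (hBQ : ∫⁻ x, ∫⁻ y, ENNReal.ofReal (gaussianKernel s x y ^ 2) ∂Q ∂ν ≤ ENNReal.ofReal B) :
    ∫⁻ w : (Fin n → Rd d) × (Fin n → Rd d), evariance (witness (gaussianKernel s) w.1 w.2) ν
        ∂((Measure.pi fun _ => P).prod (Measure.pi fun _ => Q))
      ≤ ENNReal.ofReal (2 * A + 8 * B / n) := by
  set a := meanWitness (gaussianKernel s) P Q with ha
  have ham : Measurable a := measurable_meanWitness s P Q
  -- At a fixed `x` the witness is itself a difference of two sample means, centred at the
  -- population witness `a x`.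
  have hx : ∀ x, ∫⁻ w : (Fin n → Rd d) × (Fin n → Rd d),
      ENNReal.ofReal ((witness (gaussianKernel s) w.1 w.2 x - a x) ^ 2)
        ∂((Measure.pi fun _ => P).prod (Measure.pi fun _ => Q))
      ≤ ENNReal.ofReal (2 / n) * (∫⁻ y, ENNReal.ofReal (gaussianKernel s x y ^ 2) ∂P
          + ∫⁻ y, ENNReal.ofReal (gaussianKernel s x y ^ 2) ∂Q) := by
    intro x
    have h := lintegral_sq_two_sample_le hn (b := fun y => gaussianKernel s y x) (by fun_prop)
      (memLp_gaussianKernel_right hs P x) (memLp_gaussianKernel_right hs Q x)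
    simp only [gaussianKernel_comm s _ x] at h
    refine le_trans (le_of_eq ?_) h
    simp only [witness, ha, meanWitness, gaussianKernel_comm s _ x]
  have hsqm : ∀ ν' : Measure (Rd d), IsProbabilityMeasure ν' →
      Measurable fun x => ∫⁻ y, ENNReal.ofReal (gaussianKernel s x y ^ 2) ∂ν' := fun ν' _ => by
    have : Measurable fun z : Rd d × Rd d => ENNReal.ofReal (gaussianKernel s z.1 z.2 ^ 2) := by
      fun_prop
    exact this.lintegral_prod_right'
  have hswap : ∫⁻ w : (Fin n → Rd d) × (Fin n → Rd d), ∫⁻ x,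
      ENNReal.ofReal ((witness (gaussianKernel s) w.1 w.2 x - a x) ^ 2) ∂ν
        ∂((Measure.pi fun _ => P).prod (Measure.pi fun _ => Q))
      = ∫⁻ x, ∫⁻ w : (Fin n → Rd d) × (Fin n → Rd d),
      ENNReal.ofReal ((witness (gaussianKernel s) w.1 w.2 x - a x) ^ 2)
        ∂((Measure.pi fun _ => P).prod (Measure.pi fun _ => Q)) ∂ν := by
    refine lintegral_lintegral_swap (Measurable.aemeasurable ?_)
    have : Measurable fun z : ((Fin n → Rd d) × (Fin n → Rd d)) × Rd d =>
        ENNReal.ofReal ((witness (gaussianKernel s) z.1.1 z.1.2 z.2 - a z.2) ^ 2) := by fun_prop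
    exact this
  -- The variance is at most the second moment about `0`, split as `f̂ = (f̂ - a) + a`. The
  -- estimation part gives `8 B / n` after Tonelli, the population part `2 A`.
  calc _ ≤ ∫⁻ w : (Fin n → Rd d) × (Fin n → Rd d), (2 * (∫⁻ x,
        ENNReal.ofReal ((witness (gaussianKernel s) w.1 w.2 x - a x) ^ 2) ∂ν)
        + 2 * ENNReal.ofReal A) ∂((Measure.pi fun _ => P).prod (Measure.pi fun _ => Q)) := by
        refine lintegral_mono fun w => ?_
        refine (evariance_le_lintegral_sq_sub (memLp_witness hs w.1 w.2 ν) 0).trans ?_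
        calc _ ≤ ∫⁻ x, (2 * ENNReal.ofReal
              ((witness (gaussianKernel s) w.1 w.2 x - a x) ^ 2)
              + 2 * ENNReal.ofReal (a x ^ 2)) ∂ν := by
              refine lintegral_mono fun x => ?_
              have h := ofReal_sq_add_le (witness (gaussianKernel s) w.1 w.2 x - a x) (a x)
              rw [sub_add_cancel] at h
              simpa only [sub_zero] using h
          _ ≤ _ := by
              rw [lintegral_add_right _ (by fun_prop),
                lintegral_const_mul' _ _ ENNReal.ofNat_ne_top,
                lintegral_const_mul' _ _ ENNReal.ofNat_ne_top]
              gcongr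
    _ ≤ 2 * (ENNReal.ofReal (2 / n) * (ENNReal.ofReal B + ENNReal.ofReal B))
        + 2 * ENNReal.ofReal A := by
        rw [lintegral_add_right _ measurable_const, lintegral_const, measure_univ, mul_one,
          lintegral_const_mul' _ _ ENNReal.ofNat_ne_top, hswap]
        gcongr
        refine (lintegral_mono hx).trans ?_
        rw [lintegral_const_mul' _ _ ENNReal.ofReal_ne_top,
          lintegral_add_left (hsqm P inferInstance)]
        gcongr
    _ = _ := by
        rw [← ENNReal.ofReal_ofNat, ← ENNReal.ofReal_add hB hB,
          ← ENNReal.ofReal_mul (by positivity), ← ENNReal.ofReal_mul (by positivity),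
          ← ENNReal.ofReal_mul (by positivity), ← ENNReal.ofReal_add (by positivity) (by positivity)]
        congr 1
        ring

end WitnessMoments

/-! ### Power at a single alternative -/

section TestPower

variable {d N h : ℕ} {𝒱 : Type*} [MeasurableSpace 𝒱] {s : ℝ}

/-- The law of a labelled and an unlabelled sample. -/
noncomputable def sampleLaw (N h : ℕ) (ρ : Measure (Rd d × 𝒱)) :
    Measure ((Bool × Fin N → Rd d × 𝒱) × (Bool × Fin h → 𝒱)) :=
  (Measure.pi fun _ => ρ).prod (Measure.pi fun _ => ρ.snd)

instance (ρ : Measure (Rd d × 𝒱)) [IsProbabilityMeasure ρ] :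
    IsProbabilityMeasure (sampleLaw N h ρ) := by
  unfold sampleLaw; infer_instance

instance (PXV PYW : Measure (Rd d × 𝒱)) [IsProbabilityMeasure PXV] [IsProbabilityMeasure PYW] :
    IsProbabilityMeasure (witnessLaw N PXV PYW) := by
  unfold witnessLaw; infer_instance

/-- The sample space of the points on which the witness function is built. -/
abbrev WitnessData (d N : ℕ) : Type := (Fin (2 * N) → Rd d) × (Fin (2 * N) → Rd d)

lemma measurable_muHat_witness {u : Regressor d N 𝒱}
    (hu : MeasurableRegressor (gaussianKernel s) u) :
    Measurable fun p : WitnessData d N × ((Bool × Fin N → Rd d × 𝒱) × (Bool × Fin h → 𝒱)) =>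
      muHat (witness (gaussianKernel s) p.1.1 p.1.2) (u (witness (gaussianKernel s) p.1.1 p.1.2))
        p.2.1 p.2.2 := by
  have h1 : ∀ i : Bool × Fin N, Measurable
      fun p : WitnessData d N × ((Bool × Fin N → Rd d × 𝒱) × (Bool × Fin h → 𝒱)) =>
      u (witness (gaussianKernel s) p.1.1 p.1.2) (fun i' => p.2.1 (!i.1, i')) (p.2.1 i).2 :=
    fun i => hu.comp
      (f := fun p : WitnessData d N × ((Bool × Fin N → Rd d × 𝒱) × (Bool × Fin h → 𝒱)) =>
        (p.1, (fun i' => p.2.1 (!i.1, i')), (p.2.1 i).2)) (by fun_prop)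
  have h2 : ∀ i : Bool × Fin h, Measurable
      fun p : WitnessData d N × ((Bool × Fin N → Rd d × 𝒱) × (Bool × Fin h → 𝒱)) =>
      u (witness (gaussianKernel s) p.1.1 p.1.2) (fun i' => p.2.1 (!i.1, i')) (p.2.2 i) :=
    fun i => hu.comp
      (f := fun p : WitnessData d N × ((Bool × Fin N → Rd d × 𝒱) × (Bool × Fin h → 𝒱)) =>
        (p.1, (fun i' => p.2.1 (!i.1, i')), p.2.2 i)) (by fun_prop)
  have h3 : ∀ i : Bool × Fin N, Measurable
      fun p : WitnessData d N × ((Bool × Fin N → Rd d × 𝒱) × (Bool × Fin h → 𝒱)) =>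
      witness (gaussianKernel s) p.1.1 p.1.2 (p.2.1 i).1 := fun i => by fun_prop
  unfold muHat resid fitLabelled fitUnlabelled crossFit
  exact ((Finset.measurable_fun_sum _ fun i _ => (h3 i).sub (h1 i)).const_mul _).add
    (((Finset.measurable_fun_sum _ fun i _ => h1 i).add
      (Finset.measurable_fun_sum _ fun i _ => h2 i)).const_mul _)

lemma measurable_sigmaSq_witness {u : Regressor d N 𝒱}
    (hu : MeasurableRegressor (gaussianKernel s) u) :
    Measurable fun p : WitnessData d N × ((Bool × Fin N → Rd d × 𝒱) × (Bool × Fin h → 𝒱)) =>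
      sigmaSq (witness (gaussianKernel s) p.1.1 p.1.2) (u (witness (gaussianKernel s) p.1.1 p.1.2))
        p.2.1 p.2.2 := by
  have h1 : ∀ i : Bool × Fin N, Measurable
      fun p : WitnessData d N × ((Bool × Fin N → Rd d × 𝒱) × (Bool × Fin h → 𝒱)) =>
      u (witness (gaussianKernel s) p.1.1 p.1.2) (fun i' => p.2.1 (!i.1, i')) (p.2.1 i).2 :=
    fun i => hu.comp
      (f := fun p : WitnessData d N × ((Bool × Fin N → Rd d × 𝒱) × (Bool × Fin h → 𝒱)) =>
        (p.1, (fun i' => p.2.1 (!i.1, i')), (p.2.1 i).2)) (by fun_prop)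
  have h2 : ∀ i : Bool × Fin h, Measurable
      fun p : WitnessData d N × ((Bool × Fin N → Rd d × 𝒱) × (Bool × Fin h → 𝒱)) =>
      u (witness (gaussianKernel s) p.1.1 p.1.2) (fun i' => p.2.1 (!i.1, i')) (p.2.2 i) :=
    fun i => hu.comp
      (f := fun p : WitnessData d N × ((Bool × Fin N → Rd d × 𝒱) × (Bool × Fin h → 𝒱)) =>
        (p.1, (fun i' => p.2.1 (!i.1, i')), p.2.2 i)) (by fun_prop)
  have h3 : ∀ i : Bool × Fin N, Measurable
      fun p : WitnessData d N × ((Bool × Fin N → Rd d × 𝒱) × (Bool × Fin h → 𝒱)) =>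
      witness (gaussianKernel s) p.1.1 p.1.2 (p.2.1 i).1 := fun i => by fun_prop
  unfold sigmaSq sigmaSqOne sigmaSqTwo resid fitLabelled fitUnlabelled crossFit
  refine (Measurable.const_mul (Measurable.sub ?_ ?_) _).add
    (Measurable.const_mul (Measurable.sub ?_ ?_) _)
  · exact (Finset.measurable_fun_sum _ fun i _ => ((h3 i).sub (h1 i)).pow_const 2).const_mul _
  · exact ((Finset.measurable_fun_sum _ fun i _ => (h3 i).sub (h1 i)).const_mul _).pow_const 2
  · exact ((Finset.measurable_fun_sum _ fun i _ => (h1 i).pow_const 2).add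
      (Finset.measurable_fun_sum _ fun i _ => (h2 i).pow_const 2)).const_mul _
  · exact (((Finset.measurable_fun_sum _ fun i _ => h1 i).add
      (Finset.measurable_fun_sum _ fun i _ => h2 i)).const_mul _).pow_const 2

lemma measurable_integral_witness (P : Measure (Rd d)) [SFinite P] :
    Measurable fun w : WitnessData d N => ∫ x, witness (gaussianKernel s) w.1 w.2 x ∂P := by
  have : Measurable (Function.uncurry fun (w : WitnessData d N) (x : Rd d) =>
      witness (gaussianKernel s) w.1 w.2 x) := by
    simp only [Function.uncurry_def]
    fun_prop
  exact (this.stronglyMeasurable.integral_prod_right (ν := P)).measurable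

lemma measurable_evariance_witness (P : Measure (Rd d)) [SFinite P] :
    Measurable fun w : WitnessData d N => evariance (witness (gaussianKernel s) w.1 w.2) P := by
  simp only [evariance_eq_lintegral_ofReal]
  have h1 := measurable_integral_witness (N := N) (s := s) P
  have : Measurable fun z : WitnessData d N × Rd d => ENNReal.ofReal
      ((witness (gaussianKernel s) z.1.1 z.1.2 z.2
        - ∫ x, witness (gaussianKernel s) z.1.1 z.1.2 x ∂P) ^ 2) := by
    refine ((Measurable.sub ?_ (h1.comp measurable_fst)).pow_const 2).ennreal_ofReal
    fun_prop
  exact this.lintegral_prod_right'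

variable {ν : Measure (WitnessData d N)} [IsProbabilityMeasure ν] {ρ : Measure (Rd d × 𝒱)}
  [IsProbabilityMeasure ρ] {u : Regressor d N 𝒱}

lemma measurable_witness_apply {n₁ n₂ : ℕ} (xt : Fin n₁ → Rd d) (yt : Fin n₂ → Rd d) :
    Measurable (witness (gaussianKernel s) xt yt) :=
  measurable_witness measurable_const measurable_const measurable_id

lemma measurable_regressor_apply (hu : MeasurableRegressor (gaussianKernel s) u)
    (w : WitnessData d N) : Measurable fun z : (Fin N → Rd d × 𝒱) × 𝒱 =>
      u (witness (gaussianKernel s) w.1 w.2) z.1 z.2 :=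
  hu.comp (f := fun z : (Fin N → Rd d × 𝒱) × 𝒱 => (w, z)) measurable_prodMk_left

lemma lintegral_muHat_witness_le (hs : 0 < s) (hN : 1 ≤ N)
    (hu : MeasurableRegressor (gaussianKernel s) u) :
    ∫⁻ p, ENNReal.ofReal ((muHat (witness (gaussianKernel s) p.1.1 p.1.2)
        (u (witness (gaussianKernel s) p.1.1 p.1.2)) p.2.1 p.2.2
        - ∫ x, witness (gaussianKernel s) p.1.1 p.1.2 x ∂ρ.fst) ^ 2) ∂(ν.prod (sampleLaw N h ρ))
      ≤ 12 * (ENNReal.ofReal (1 / N) * (residualSecondMoment (gaussianKernel s) u ν ρ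
          + expectedCondVariance (gaussianKernel s) ν ρ)) := by
  have h1 := measurable_muHat_witness (h := h) hu
  have h2 := measurable_integral_witness (N := N) (s := s) ρ.fst
  have hm : Measurable
      fun p : WitnessData d N × ((Bool × Fin N → Rd d × 𝒱) × (Bool × Fin h → 𝒱)) =>
      ENNReal.ofReal ((muHat (witness (gaussianKernel s) p.1.1 p.1.2)
        (u (witness (gaussianKernel s) p.1.1 p.1.2)) p.2.1 p.2.2
        - ∫ x, witness (gaussianKernel s) p.1.1 p.1.2 x ∂ρ.fst) ^ 2) :=
    ((h1.sub (h2.comp measurable_fst)).pow_const 2).ennreal_ofReal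
  rw [lintegral_prod _ hm.aemeasurable]
  have key : ∀ w : WitnessData d N, ∫⁻ x,
      ENNReal.ofReal ((muHat (witness (gaussianKernel s) w.1 w.2)
        (u (witness (gaussianKernel s) w.1 w.2)) x.1 x.2
        - ∫ x, witness (gaussianKernel s) w.1 w.2 x ∂ρ.fst) ^ 2) ∂(sampleLaw N h ρ)
      ≤ 12 * (ENNReal.ofReal (1 / N) * (∫⁻ S, ∫⁻ z, ENNReal.ofReal
        ((witness (gaussianKernel s) w.1 w.2 z.1
          - u (witness (gaussianKernel s) w.1 w.2) S z.2) ^ 2) ∂ρ ∂(Measure.pi fun _ => ρ)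
          + evariance (witness (gaussianKernel s) w.1 w.2) ρ.fst)) := fun w =>
    lintegral_muHat_sub_sq_le hN (measurable_witness_apply w.1 w.2)
      (memLp_witness hs w.1 w.2 ρ.fst) (measurable_regressor_apply hu w)
  refine (lintegral_mono key).trans (le_of_eq ?_)
  rw [residualSecondMoment, expectedCondVariance, lintegral_const_mul' _ _ ENNReal.ofNat_ne_top,
    lintegral_const_mul' _ _ ENNReal.ofReal_ne_top,
    lintegral_add_right _ (measurable_evariance_witness ρ.fst)]

lemma lintegral_sigmaSq_witness_le (hs : 0 < s) (hN : 1 ≤ N)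
    (hu : MeasurableRegressor (gaussianKernel s) u) :
    ∫⁻ p, ENNReal.ofReal (sigmaSq (witness (gaussianKernel s) p.1.1 p.1.2)
        (u (witness (gaussianKernel s) p.1.1 p.1.2)) p.2.1 p.2.2) ∂(ν.prod (sampleLaw N h ρ))
      ≤ 2 * (ENNReal.ofReal (1 / N) * (residualSecondMoment (gaussianKernel s) u ν ρ
          + expectedCondVariance (gaussianKernel s) ν ρ)) := by
  have h1 := measurable_sigmaSq_witness (h := h) hu
  rw [lintegral_prod _ h1.ennreal_ofReal.aemeasurable]
  have key : ∀ w : WitnessData d N, ∫⁻ x,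
      ENNReal.ofReal (sigmaSq (witness (gaussianKernel s) w.1 w.2)
        (u (witness (gaussianKernel s) w.1 w.2)) x.1 x.2) ∂(sampleLaw N h ρ)
      ≤ 2 * (ENNReal.ofReal (1 / N) * (∫⁻ S, ∫⁻ z, ENNReal.ofReal
        ((witness (gaussianKernel s) w.1 w.2 z.1
          - u (witness (gaussianKernel s) w.1 w.2) S z.2) ^ 2) ∂ρ ∂(Measure.pi fun _ => ρ)
          + evariance (witness (gaussianKernel s) w.1 w.2) ρ.fst)) := fun w =>
    lintegral_sigmaSq_le hN (measurable_witness_apply w.1 w.2)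
      (memLp_witness hs w.1 w.2 ρ.fst) (measurable_regressor_apply hu w)
  refine (lintegral_mono key).trans (le_of_eq ?_)
  rw [residualSecondMoment, expectedCondVariance, lintegral_const_mul' _ _ ENNReal.ofNat_ne_top,
    lintegral_const_mul' _ _ ENNReal.ofReal_ne_top,
    lintegral_add_right _ (measurable_evariance_witness ρ.fst)]

/-- Markov's inequality. As `t > 0`, truncating negative values of `F` to `0` does not change the
event. -/
lemma measure_ofReal_le_le {Ω : Type*} [MeasurableSpace Ω] {μ : Measure Ω} {F : Ω → ℝ}
    (hF : Measurable F) {t x : ℝ} (ht : 0 < t)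
    (hx : ∫⁻ ω, ENNReal.ofReal (F ω) ∂μ ≤ ENNReal.ofReal x) :
    μ {ω | t ≤ F ω} ≤ ENNReal.ofReal (x / t) := by
  calc μ {ω | t ≤ F ω} ≤ μ {ω | ENNReal.ofReal t ≤ ENNReal.ofReal (F ω)} :=
        measure_mono fun ω hω => ENNReal.ofReal_le_ofReal hω
    _ ≤ (∫⁻ ω, ENNReal.ofReal (F ω) ∂μ) / ENNReal.ofReal t :=
        meas_ge_le_lintegral_div (by fun_prop) (by simpa using ht) ENNReal.ofReal_ne_top
    _ ≤ ENNReal.ofReal x / ENNReal.ofReal t := by gcongr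
    _ = ENNReal.ofReal (x / t) := (ENNReal.ofReal_div_of_pos ht).symm

/-- The bound on `v` says `√v < γ / (4 Z)`, hence `z √v < γ / 4 < a`. If `v ≤ 0`, the ratio is `⊤`
because `a > 0`. -/
lemma lt_studentize {a v z Z γ : ℝ} (hγ : 0 < γ) (hZ : 0 < Z) (hzZ : z ≤ Z) (ha : γ / 4 < a)
    (hv : v < γ ^ 2 / (16 * Z ^ 2)) : (z : EReal) < studentize a v := by
  have ha0 : 0 < a := by linarith
  unfold studentize
  split_ifs with h1
  · rw [EReal.coe_lt_coe_iff, lt_div_iff₀ (Real.sqrt_pos.2 h1)]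
    have h2 : √v < γ / (4 * Z) := by
      rw [Real.sqrt_lt' (by positivity)]
      refine hv.trans_le (le_of_eq ?_)
      rw [div_pow, mul_pow]
      norm_num
    calc z * √v ≤ Z * √v := by gcongr
      _ < Z * (γ / (4 * Z)) := by gcongr
      _ = γ / 4 := by field_simp
      _ < a := ha
  · exact EReal.coe_lt_top z

/-- The errors of one sample involve only the witness points and that sample, so the other sample
can be projected away. -/
lemma measurePreserving_data_left {h₁ h₂ : ℕ} (PXV PYW : Measure (Rd d × 𝒱))
    [IsProbabilityMeasure PXV] [IsProbabilityMeasure PYW] :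
    MeasurePreserving (fun D : Data d N h₁ h₂ 𝒱 => (D.1, D.2.1)) (dataLaw N h₁ h₂ PXV PYW)
      ((witnessLaw N PXV PYW).prod (sampleLaw N h₁ PXV)) :=
  (MeasurePreserving.id (witnessLaw N PXV PYW)).prod
    (measurePreserving_fst (μ := sampleLaw N h₁ PXV) (ν := sampleLaw N h₂ PYW))

lemma measurePreserving_data_right {h₁ h₂ : ℕ} (PXV PYW : Measure (Rd d × 𝒱))
    [IsProbabilityMeasure PXV] [IsProbabilityMeasure PYW] :
    MeasurePreserving (fun D : Data d N h₁ h₂ 𝒱 => (D.1, D.2.2)) (dataLaw N h₁ h₂ PXV PYW)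
      ((witnessLaw N PXV PYW).prod (sampleLaw N h₂ PYW)) :=
  (MeasurePreserving.id (witnessLaw N PXV PYW)).prod
    (measurePreserving_snd (μ := sampleLaw N h₁ PXV) (ν := sampleLaw N h₂ PYW))

lemma measurePreserving_data_fst {h₁ h₂ : ℕ} (PXV PYW : Measure (Rd d × 𝒱))
    [IsProbabilityMeasure PXV] [IsProbabilityMeasure PYW] :
    MeasurePreserving (fun D : Data d N h₁ h₂ 𝒱 => D.1) (dataLaw N h₁ h₂ PXV PYW)
      (witnessLaw N PXV PYW) :=
  measurePreserving_fst (μ := witnessLaw N PXV PYW)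
    (ν := (sampleLaw N h₁ PXV).prod (sampleLaw N h₂ PYW))

/-- Type II error contributions of one sample. -/
lemma measure_sample_deviation_le {Ω : Type*} [MeasurableSpace Ω] {μ : Measure Ω} (hs : 0 < s)
    (hN : 1 ≤ N) (hu : MeasurableRegressor (gaussianKernel s) u)
    {π : Ω → WitnessData d N × ((Bool × Fin N → Rd d × 𝒱) × (Bool × Fin h → 𝒱))}
    (hπ : MeasurePreserving π μ (ν.prod (sampleLaw N h ρ))) {C : ℝ≥0} {V γ Z : ℝ} (hV : 0 ≤ V)
    (hγ : 0 < γ) (hZ : 0 < Z)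
    (hres : residualSecondMoment (gaussianKernel s) u ν ρ
      ≤ C * expectedCondVariance (gaussianKernel s) ν ρ)
    (hvar : expectedCondVariance (gaussianKernel s) ν ρ ≤ ENNReal.ofReal V) :
    μ {D | γ ^ 2 / 64 ≤ (muHat (witness (gaussianKernel s) (π D).1.1 (π D).1.2)
        (u (witness (gaussianKernel s) (π D).1.1 (π D).1.2)) (π D).2.1 (π D).2.2
        - ∫ x, witness (gaussianKernel s) (π D).1.1 (π D).1.2 x ∂ρ.fst) ^ 2}
      + μ {D | γ ^ 2 / (32 * Z ^ 2) ≤ sigmaSq (witness (gaussianKernel s) (π D).1.1 (π D).1.2)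
        (u (witness (gaussianKernel s) (π D).1.1 (π D).1.2)) (π D).2.1 (π D).2.2}
      ≤ ENNReal.ofReal ((C + 1) * (768 + 64 * Z ^ 2) * (V / N) / γ ^ 2) := by
  have hN0 : (0 : ℝ) < N := by exact_mod_cast hN
  have hmu := measurable_muHat_witness (h := h) hu
  have hsig := measurable_sigmaSq_witness (h := h) hu
  have hint := measurable_integral_witness (N := N) (s := s) ρ.fst
  have hπm := hπ.measurable
  -- The only use of the residual condition: the risk is absorbed in the expected conditional
  -- variance.
  have hsum : residualSecondMoment (gaussianKernel s) u ν ρ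
      + expectedCondVariance (gaussianKernel s) ν ρ ≤ ENNReal.ofReal ((C + 1) * V) := by
    calc _ ≤ (C + 1) * expectedCondVariance (gaussianKernel s) ν ρ := by
          rw [add_mul, one_mul]; gcongr
      _ ≤ (C + 1) * ENNReal.ofReal V := by gcongr
      _ = _ := by
        have hC : (0 : ℝ) ≤ C := C.2
        rw [ENNReal.ofReal_mul (by positivity), ENNReal.ofReal_add hC zero_le_one,
          ENNReal.ofReal_coe_nnreal, ENNReal.ofReal_one]
  have hA : ∫⁻ D, ENNReal.ofReal ((muHat (witness (gaussianKernel s) (π D).1.1 (π D).1.2)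
        (u (witness (gaussianKernel s) (π D).1.1 (π D).1.2)) (π D).2.1 (π D).2.2
        - ∫ x, witness (gaussianKernel s) (π D).1.1 (π D).1.2 x ∂ρ.fst) ^ 2) ∂μ
      ≤ ENNReal.ofReal (12 * (1 / N * ((C + 1) * V))) := by
    have := hπ.lintegral_comp (f := fun p =>
      ENNReal.ofReal ((muHat (witness (gaussianKernel s) p.1.1 p.1.2)
        (u (witness (gaussianKernel s) p.1.1 p.1.2)) p.2.1 p.2.2
        - ∫ x, witness (gaussianKernel s) p.1.1 p.1.2 x ∂ρ.fst) ^ 2))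
      ((hmu.sub (hint.comp measurable_fst)).pow_const 2).ennreal_ofReal
    rw [this, ENNReal.ofReal_mul (by norm_num), ENNReal.ofReal_mul (by positivity),
      ENNReal.ofReal_ofNat]
    exact (lintegral_muHat_witness_le hs hN hu).trans (by gcongr)
  have hB : ∫⁻ D, ENNReal.ofReal (sigmaSq (witness (gaussianKernel s) (π D).1.1 (π D).1.2)
        (u (witness (gaussianKernel s) (π D).1.1 (π D).1.2)) (π D).2.1 (π D).2.2) ∂μ
      ≤ ENNReal.ofReal (2 * (1 / N * ((C + 1) * V))) := by
    have := hπ.lintegral_comp (f := fun p =>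
      ENNReal.ofReal (sigmaSq (witness (gaussianKernel s) p.1.1 p.1.2)
        (u (witness (gaussianKernel s) p.1.1 p.1.2)) p.2.1 p.2.2)) hsig.ennreal_ofReal
    rw [this, ENNReal.ofReal_mul (by norm_num), ENNReal.ofReal_mul (by positivity),
      ENNReal.ofReal_ofNat]
    exact (lintegral_sigmaSq_witness_le hs hN hu).trans (by gcongr)
  have hmA : Measurable fun D => (muHat (witness (gaussianKernel s) (π D).1.1 (π D).1.2)
        (u (witness (gaussianKernel s) (π D).1.1 (π D).1.2)) (π D).2.1 (π D).2.2
        - ∫ x, witness (gaussianKernel s) (π D).1.1 (π D).1.2 x ∂ρ.fst) ^ 2 :=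
    ((hmu.sub (hint.comp measurable_fst)).pow_const 2).comp hπm
  have hmB : Measurable fun D => sigmaSq (witness (gaussianKernel s) (π D).1.1 (π D).1.2)
        (u (witness (gaussianKernel s) (π D).1.1 (π D).1.2)) (π D).2.1 (π D).2.2 :=
    hsig.comp hπm
  refine (add_le_add (measure_ofReal_le_le hmA (by positivity) hA)
    (measure_ofReal_le_le hmB (by positivity) hB)).trans (le_of_eq ?_)
  rw [← ENNReal.ofReal_add (by positivity) (by positivity)]
  congr 1
  field_simp
  ring

/-- A lower bound for the power of the test at a single alternative. -/
theorem one_sub_le_xssPower {h₁ h₂ : ℕ} {α : ℝ} {uX uY : Regressor d N 𝒱}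
    {PXV PYW : Measure (Rd d × 𝒱)} [IsProbabilityMeasure PXV] [IsProbabilityMeasure PYW]
    (hs : 0 < s) (hN : 1 ≤ N) (huX : MeasurableRegressor (gaussianKernel s) uX)
    (huY : MeasurableRegressor (gaussianKernel s) uY) {C : ℝ≥0}
    (hres : ResidualCondition (gaussianKernel s) uX uY C PXV PYW) {A B : ℝ} (hA : 0 ≤ A)
    (hB : 0 ≤ B)
    (hAX : ∫⁻ y, ENNReal.ofReal (meanWitness (gaussianKernel s) PXV.fst PYW.fst y ^ 2) ∂PXV.fst
      ≤ ENNReal.ofReal A)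
    (hAY : ∫⁻ y, ENNReal.ofReal (meanWitness (gaussianKernel s) PXV.fst PYW.fst y ^ 2) ∂PYW.fst
      ≤ ENNReal.ofReal A)
    (hXX : ∫⁻ x, ∫⁻ y, ENNReal.ofReal (gaussianKernel s x y ^ 2) ∂PXV.fst ∂PXV.fst
      ≤ ENNReal.ofReal B)
    (hXY : ∫⁻ x, ∫⁻ y, ENNReal.ofReal (gaussianKernel s x y ^ 2) ∂PYW.fst ∂PXV.fst
      ≤ ENNReal.ofReal B)
    (hYX : ∫⁻ x, ∫⁻ y, ENNReal.ofReal (gaussianKernel s x y ^ 2) ∂PXV.fst ∂PYW.fst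
      ≤ ENNReal.ofReal B)
    (hYY : ∫⁻ x, ∫⁻ y, ENNReal.ofReal (gaussianKernel s x y ^ 2) ∂PYW.fst ∂PYW.fst
      ≤ ENNReal.ofReal B)
    (hγ : 0 < mmdSq (gaussianKernel s) PXV.fst PYW.fst) :
    1 - (4 + (C + 1) * (1536 + 128 * (|normalQuantile (1 - α)| + 1) ^ 2))
        * ((2 * A + 4 * B / N) / N) / mmdSq (gaussianKernel s) PXV.fst PYW.fst ^ 2
      ≤ xssPower h₁ h₂ α (gaussianKernel s) uX uY PXV PYW := by
  set γ := mmdSq (gaussianKernel s) PXV.fst PYW.fst with hγdef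
  set z := normalQuantile (1 - α) with hz
  -- A positive upper bound for the quantile, whatever its sign.
  set Z := |z| + 1 with hZdef
  have hZ : 0 < Z := by positivity
  have hN0 : (0 : ℝ) < N := by exact_mod_cast hN
  have hn : 1 ≤ 2 * N := by omega
  set V := 2 * A + 4 * B / N with hV
  have hV0 : 0 ≤ V := by positivity
  have hVn : 2 * A + 8 * B / ((2 * N : ℕ) : ℝ) = V := by
    rw [hV]; push_cast; field_simp; ring
  have hvarX : expectedCondVariance (gaussianKernel s) (witnessLaw N PXV PYW) PXV
      ≤ ENNReal.ofReal V := by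
    rw [← hVn]
    exact lintegral_evariance_witness_le PXV.fst PYW.fst hs hn PXV.fst hA hB hAX hXX hXY
  have hvarY : expectedCondVariance (gaussianKernel s) (witnessLaw N PXV PYW) PYW
      ≤ ENNReal.ofReal V := by
    rw [← hVn]
    exact lintegral_evariance_witness_le PXV.fst PYW.fst hs hn PYW.fst hA hB hAY hYX hYY
  set μ := dataLaw N h₁ h₂ PXV PYW with hμ
  have hμp : IsProbabilityMeasure μ := by rw [hμ]; unfold dataLaw; infer_instance
  have hdevX := measure_sample_deviation_le hs hN huX
    (measurePreserving_data_left (N := N) (h₁ := h₁) (h₂ := h₂) PXV PYW) hV0 hγ hZ hres.1 hvarX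
  have hdevY := measure_sample_deviation_le hs hN huY
    (measurePreserving_data_right (N := N) (h₁ := h₁) (h₂ := h₂) PXV PYW) hV0 hγ hZ hres.2 hvarY
  have hθm : Measurable fun w : WitnessData d N =>
      (∫ x, witness (gaussianKernel s) w.1 w.2 x ∂PXV.fst
        - ∫ x, witness (gaussianKernel s) w.1 w.2 x ∂PYW.fst - γ) ^ 2 :=
    (((measurable_integral_witness PXV.fst).sub
      (measurable_integral_witness PYW.fst)).sub_const γ).pow_const 2
  have hθ := measure_ofReal_le_le (t := γ ^ 2 / 4)
    (hθm.comp (measurePreserving_data_fst (N := N) (h₁ := h₁) (h₂ := h₂) PXV PYW).measurable)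
    (by positivity) (x := 4 * A / ((2 * N : ℕ) : ℝ)) (by
      refine le_trans (le_of_eq ?_)
        (lintegral_witness_sub_mmdSq_le PXV.fst PYW.fst hs hn hA hAX hAY)
      exact (measurePreserving_data_fst (N := N) (h₁ := h₁) (h₂ := h₂) PXV PYW).lintegral_comp
        (f := fun w => ENNReal.ofReal ((∫ x, witness (gaussianKernel s) w.1 w.2 x ∂PXV.fst
        - ∫ x, witness (gaussianKernel s) w.1 w.2 x ∂PYW.fst - γ) ^ 2)) hθm.ennreal_ofReal)
  simp only [Function.comp_def] at hθ
  set E₀ := {D : Data d N h₁ h₂ 𝒱 | γ ^ 2 / 4 ≤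
      (∫ x, witness (gaussianKernel s) D.1.1 D.1.2 x ∂PXV.fst
        - ∫ x, witness (gaussianKernel s) D.1.1 D.1.2 x ∂PYW.fst - γ) ^ 2} with hE₀
  set E₁ := {D : Data d N h₁ h₂ 𝒱 | γ ^ 2 / 64 ≤ (muHat (witness (gaussianKernel s) D.1.1 D.1.2)
        (uX (witness (gaussianKernel s) D.1.1 D.1.2)) D.2.1.1 D.2.1.2
        - ∫ x, witness (gaussianKernel s) D.1.1 D.1.2 x ∂PXV.fst) ^ 2} with hE₁
  set E₂ := {D : Data d N h₁ h₂ 𝒱 | γ ^ 2 / (32 * Z ^ 2) ≤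
      sigmaSq (witness (gaussianKernel s) D.1.1 D.1.2)
        (uX (witness (gaussianKernel s) D.1.1 D.1.2)) D.2.1.1 D.2.1.2} with hE₂
  set E₃ := {D : Data d N h₁ h₂ 𝒱 | γ ^ 2 / 64 ≤ (muHat (witness (gaussianKernel s) D.1.1 D.1.2)
        (uY (witness (gaussianKernel s) D.1.1 D.1.2)) D.2.2.1 D.2.2.2
        - ∫ x, witness (gaussianKernel s) D.1.1 D.1.2 x ∂PYW.fst) ^ 2} with hE₃
  set E₄ := {D : Data d N h₁ h₂ 𝒱 | γ ^ 2 / (32 * Z ^ 2) ≤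
      sigmaSq (witness (gaussianKernel s) D.1.1 D.1.2)
        (uY (witness (gaussianKernel s) D.1.1 D.1.2)) D.2.2.1 D.2.2.2} with hE₄
  set G := {D : Data d N h₁ h₂ 𝒱 | (z : EReal) < xssStatistic (gaussianKernel s) uX uY D} with hG
  -- Off the bad events the numerator exceeds `γ - γ/2 - γ/8 - γ/8 = γ/4`, and the two variance
  -- estimates sum to less than `γ²/(16 Z²)`: the thresholds of `lt_studentize`.
  have hcover : Set.univ ⊆ G ∪ (E₀ ∪ ((E₁ ∪ E₂) ∪ (E₃ ∪ E₄))) := by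
    intro D _
    by_contra hD
    simp only [Set.mem_union, not_or] at hD
    obtain ⟨hDG, h0, ⟨h1, h2⟩, h3, h4⟩ := hD
    simp only [hE₀, hE₁, hE₂, hE₃, hE₄, Set.mem_ofPred_eq, not_le] at h0 h1 h2 h3 h4
    refine hDG ?_
    simp only [hG, Set.mem_ofPred_eq, xssStatistic]
    refine lt_studentize hγ hZ ((le_abs_self z).trans (by linarith)) ?_ ?_
    · have e0 := abs_lt_of_sq_lt_sq (h0.trans_le (by ring_nf; rfl : γ ^ 2 / 4 ≤ (γ / 2) ^ 2))
        (by positivity)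
      have e1 := abs_lt_of_sq_lt_sq (h1.trans_le (by ring_nf; rfl : γ ^ 2 / 64 ≤ (γ / 8) ^ 2))
        (by positivity)
      have e3 := abs_lt_of_sq_lt_sq (h3.trans_le (by ring_nf; rfl : γ ^ 2 / 64 ≤ (γ / 8) ^ 2))
        (by positivity)
      rw [abs_lt] at e0 e1 e3
      linarith
    · refine (add_lt_add h2 h4).trans_le (le_of_eq ?_)
      field_simp
      norm_num
  have hq : 8 * A / N ≤ 4 * (V / N) := by
    have h1 : 0 ≤ 4 * B / N := by positivity
    have h2 : 8 * A ≤ 4 * V := by rw [hV]; linarith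
    rw [← mul_div_assoc]
    exact div_le_div_of_nonneg_right h2 hN0.le
  -- A union bound over a cover of the whole space; it does not require the rejection region `G` to
  -- be measurable.
  have hbound : (1 : ℝ≥0∞) ≤ μ G + ENNReal.ofReal
      ((4 + (C + 1) * (1536 + 128 * Z ^ 2)) * (V / N) / γ ^ 2) := by
    calc (1 : ℝ≥0∞) = μ Set.univ := measure_univ.symm
      _ ≤ μ G + (μ E₀ + ((μ E₁ + μ E₂) + (μ E₃ + μ E₄))) := by
        refine (measure_mono hcover).trans ((measure_union_le _ _).trans ?_)
        gcongr
        refine (measure_union_le _ _).trans ?_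
        gcongr
        refine (measure_union_le _ _).trans ?_
        gcongr <;> exact measure_union_le _ _
      _ ≤ μ G + (ENNReal.ofReal (4 * A / ((2 * N : ℕ) : ℝ) / (γ ^ 2 / 4))
          + (ENNReal.ofReal ((C + 1) * (768 + 64 * Z ^ 2) * (V / N) / γ ^ 2)
          + ENNReal.ofReal ((C + 1) * (768 + 64 * Z ^ 2) * (V / N) / γ ^ 2))) := by
        gcongr
      _ ≤ _ := by
        rw [← ENNReal.ofReal_add (by positivity) (by positivity),
          ← ENNReal.ofReal_add (by positivity) (by positivity)]
        gcongr
        have e1 : 4 * A / ((2 * N : ℕ) : ℝ) / (γ ^ 2 / 4) = 8 * A / N / γ ^ 2 := by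
          push_cast; field_simp; ring
        have e2 : (4 + (C + 1) * (1536 + 128 * Z ^ 2)) * (V / N) / γ ^ 2
            = 4 * (V / N) / γ ^ 2 + ((C + 1) * (768 + 64 * Z ^ 2) * (V / N) / γ ^ 2
              + (C + 1) * (768 + 64 * Z ^ 2) * (V / N) / γ ^ 2) := by ring
        rw [e1, e2]
        gcongr
  have hreal := ENNReal.toReal_mono (by finiteness) hbound
  rw [ENNReal.toReal_one, ENNReal.toReal_add (by finiteness) (by finiteness),
    ENNReal.toReal_ofReal (by positivity)] at hreal
  have : xssPower h₁ h₂ α (gaussianKernel s) uX uY PXV PYW = (μ G).toReal := rfl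
  rw [this]
  linarith

end TestPower

/-! ### Uniform power over smooth alternatives -/

section Uniformity

variable {d N : ℕ} {𝒱 : Type*} [MeasurableSpace 𝒱] {s β M : ℝ}

/-- The normalized size of the noise of the estimated discrepancy. -/
noncomputable def noiseLevel (d N : ℕ) (s M δ : ℝ) : ℝ :=
  √M / (N * √(kernelMass d s) * δ ^ 2)

lemma noiseLevel_nonneg (d N : ℕ) (s M δ : ℝ) : 0 ≤ noiseLevel d N s M δ := by
  unfold noiseLevel; positivity

/-- A constant bounding the error of the test by a multiple of the noise level. -/
noncomputable def errorConst (α : ℝ) (C : ℝ≥0) : ℝ :=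
  (4 + (C + 1) * (1536 + 128 * (|normalQuantile (1 - α)| + 1) ^ 2))
    / (Real.exp (-Real.pi ^ 2) / 2) ^ 2

lemma errorConst_nonneg (α : ℝ) (C : ℝ≥0) : 0 ≤ errorConst α C := by
  unfold errorConst; positivity

/-- With `τ = √M / (N √c D²)`, dividing by `(c κ D²)²` turns the `A`-term into `2 τ / κ²` and the
`B`-term into `4 τ² / κ²`. Both decrease in `D`, so `D` may be replaced by its lower bound `δ`. -/
lemma noise_div_signal_le {A B c D δ κ γ M : ℝ} (hN : 1 ≤ N) (hc : 0 < c) (hδ : 0 < δ)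
    (hδD : δ ^ 2 ≤ D ^ 2) (hκ : 0 < κ) (hM : 0 < M) (hγ : c * (κ * D ^ 2) ≤ γ)
    (hA : A = √c * c * √M * D ^ 2) (hB : B = c * M) :
    ((2 * A + 4 * B / N) / N) / γ ^ 2
      ≤ (2 * (√M / (N * √c * δ ^ 2)) + 4 * (√M / (N * √c * δ ^ 2)) ^ 2) / κ ^ 2 := by
  have hN0 : (0 : ℝ) < N := by exact_mod_cast hN
  have hD2 : 0 < D ^ 2 := (by positivity : 0 < δ ^ 2).trans_le hδD
  have hτ : √M / (N * √c * D ^ 2) ≤ √M / (N * √c * δ ^ 2) := by gcongr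
  have hτ0 : 0 ≤ √M / (N * √c * D ^ 2) := by positivity
  have h1 : ((2 * A + 4 * B / N) / N) / γ ^ 2
      ≤ ((2 * A + 4 * B / N) / N) / (c * (κ * D ^ 2)) ^ 2 := by
    rw [hA, hB]
    gcongr
  have hsc : √c ^ 2 = c := Real.sq_sqrt hc.le
  have hsM : √M ^ 2 = M := Real.sq_sqrt hM.le
  have hsc0 : 0 < √c := Real.sqrt_pos.2 hc
  have h2 : ((2 * A + 4 * B / N) / N) / (c * (κ * D ^ 2)) ^ 2
      = (2 * (√M / (N * √c * D ^ 2)) + 4 * (√M / (N * √c * D ^ 2)) ^ 2) / κ ^ 2 := by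
    rw [hA, hB]
    generalize √c = x at *
    generalize √M = y at *
    subst hsc hsM
    have : D ≠ 0 := by rintro rfl; simp at hD2
    field_simp
  rw [h2] at h1
  refine h1.trans ?_
  gcongr

lemma sq_le_of_le_eLpNorm {g : Rd d → ℝ} {δ D : ℝ} (hδ : 0 ≤ δ)
    (hg : ∫⁻ x, ENNReal.ofReal (g x ^ 2) = ENNReal.ofReal (D ^ 2))
    (h : ENNReal.ofReal δ ≤ eLpNorm g 2 volume) : δ ^ 2 ≤ D ^ 2 := by
  have h2 : eLpNorm g 2 volume ^ 2 = ∫⁻ x, ENNReal.ofReal (g x ^ 2) := by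
    rw [← ENNReal.rpow_ofNat, eLpNorm_eq_lintegral_rpow_enorm_toReal two_ne_zero
      ENNReal.ofNat_ne_top, ← ENNReal.rpow_mul]
    simp only [ENNReal.toReal_ofNat, one_div, ne_eq, OfNat.ofNat_ne_zero, not_false_eq_true,
      inv_mul_cancel₀, ENNReal.rpow_one, ENNReal.rpow_ofNat]
    refine lintegral_congr fun x => ?_
    rw [← sq_abs, ENNReal.ofReal_pow (abs_nonneg _), ← Real.norm_eq_abs, ofReal_norm]
  have h3 : ENNReal.ofReal (δ ^ 2) ≤ ENNReal.ofReal (D ^ 2) := by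
    rw [← hg, ← h2, ENNReal.ofReal_pow hδ]
    gcongr
  exact (ENNReal.ofReal_le_ofReal_iff (sq_nonneg D)).1 h3

/-- A lower bound for the power of the test that is uniform over smooth alternatives. -/
theorem one_sub_le_xssPower_of_smoothAlternatives {h₁ h₂ : ℕ} {α : ℝ} {uX uY : Regressor d N 𝒱}
    {PXV PYW : Measure (Rd d × 𝒱)} [IsProbabilityMeasure PXV] [IsProbabilityMeasure PYW]
    (hs : 0 < s) (hβ : 0 < β) (hN : 1 ≤ N) (huX : MeasurableRegressor (gaussianKernel s) uX)
    (huY : MeasurableRegressor (gaussianKernel s) uY) {C : ℝ≥0}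
    (hres : ResidualCondition (gaussianKernel s) uX uY C PXV PYW) {δ : ℝ} (hδ : 0 < δ)
    (halt : (PXV.fst, PYW.fst) ∈ smoothAlternatives d β M δ)
    (hbias : s ^ (-β) * (4 * M) ≤ δ ^ 2 / 2) :
    1 - errorConst α C * (2 * noiseLevel d N s M δ + 4 * noiseLevel d N s M δ ^ 2)
      ≤ xssPower h₁ h₂ α (gaussianKernel s) uX uY PXV PYW := by
  obtain ⟨p, hp, q, hq, hp0, hq0, hX, hY, hpq⟩ := halt
  simp only at hX hY
  have hM := pos_of_mem_sobolevBall hp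
  set c := kernelMass d s with hc
  have hc0 : 0 < c := kernelMass_pos hs
  have hg : Integrable (p - q) := hp.1.sub hq.1
  have hF := integrable_sq_of_integrable_weighted hβ hg (sub_mem_fourier_bounds hp hq).1
  set D := √(∫ ω : Rd d, ‖fourierReal (p - q) ω‖ ^ 2) with hD
  have hDsq : D ^ 2 = ∫ ω : Rd d, ‖fourierReal (p - q) ω‖ ^ 2 :=
    Real.sq_sqrt (integral_nonneg fun ω => by positivity)
  have hgD : ∫⁻ x, ENNReal.ofReal ((p - q) x ^ 2) = ENNReal.ofReal (D ^ 2) := by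
    rw [hDsq]; exact lintegral_sq_eq_fourierReal hg hF
  have hδD : δ ^ 2 ≤ D ^ 2 := sq_le_of_le_eLpNorm hδ.le hgD hpq
  have hD2 : 0 < D ^ 2 := (by positivity : 0 < δ ^ 2).trans_le hδD
  have hD0 : 0 < D := by
    have : D ≠ 0 := fun h => by rw [h] at hD2; simp at hD2
    exact lt_of_le_of_ne (Real.sqrt_nonneg _) this.symm
  have hX' : PXV.fst = densityMeasure p := hX
  have hY' : PYW.fst = densityMeasure q := hY
  have hpp : IsProbabilityMeasure (densityMeasure p) := hX' ▸ inferInstance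
  have hqp : IsProbabilityMeasure (densityMeasure q) := hY' ▸ inferInstance
  have hγ : c * (Real.exp (-Real.pi ^ 2) / 2 * D ^ 2)
      ≤ mmdSq (gaussianKernel s) PXV.fst PYW.fst := by
    rw [hX', hY']
    refine le_trans ?_ (le_mmdSq hs hβ hp hq hp0 hq0)
    rw [← hDsq, ← hc]
    refine mul_le_mul_of_nonneg_left ?_ hc0.le
    -- The high-frequency loss is at most `δ² / 2 ≤ D² / 2`, so half of the signal survives.
    have := mul_le_mul_of_nonneg_left (by linarith : D ^ 2 / 2 ≤ D ^ 2 - s ^ (-β) * (4 * M))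
      (Real.exp_pos (-Real.pi ^ 2)).le
    linarith
  have hγ0 : 0 < mmdSq (gaussianKernel s) PXV.fst PYW.fst :=
    (by positivity : 0 < c * (Real.exp (-Real.pi ^ 2) / 2 * D ^ 2)).trans_le hγ
  have hpow := one_sub_le_xssPower (h₁ := h₁) (h₂ := h₂) (α := α) hs hN huX huY hres
    (A := √c * c * √M * D ^ 2) (B := c * M) (by positivity) (by positivity)
    (by rw [hX', hY']; exact lintegral_meanWitness_sq_le hs hβ hp hq hp hp0 hq0 hp0 hD0 hgD.le)
    (by rw [hX', hY']; exact lintegral_meanWitness_sq_le hs hβ hp hq hq hp0 hq0 hq0 hD0 hgD.le)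
    (by rw [hX']; exact lintegral_gaussianKernel_sq_le hs hβ hp hp hp0)
    (by rw [hX', hY']; exact lintegral_gaussianKernel_sq_le hs hβ hp hq hp0)
    (by rw [hX', hY']; exact lintegral_gaussianKernel_sq_le hs hβ hq hp hq0)
    (by rw [hY']; exact lintegral_gaussianKernel_sq_le hs hβ hq hq hq0) hγ0
  refine le_trans ?_ hpow
  have hnoise := noise_div_signal_le (N := N) (M := M) hN hc0 hδ hδD
    (by positivity : 0 < Real.exp (-Real.pi ^ 2) / 2) hM hγ rfl rfl
  rw [mul_div_assoc, errorConst, noiseLevel, div_mul_eq_mul_div, mul_div_assoc]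
  gcongr

lemma worstCasePower_le_one (h₁ h₂ : ℕ) (α : ℝ) (k : Rd d → Rd d → ℝ) (uX uY : Regressor d N 𝒱)
    (𝒬 : Set (ProbabilityMeasure (Rd d × 𝒱) × ProbabilityMeasure (Rd d × 𝒱))) :
    worstCasePower h₁ h₂ α k uX uY 𝒬 ≤ 1 := by
  refine csInf_le ⟨0, ?_⟩ (Set.mem_insert _ _)
  rintro b (rfl | ⟨q, -, rfl⟩)
  · exact zero_le_one
  · exact measureReal_nonneg

lemma le_worstCasePower {h₁ h₂ : ℕ} {α : ℝ} {k : Rd d → Rd d → ℝ} {uX uY : Regressor d N 𝒱}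
    {𝒬 : Set (ProbabilityMeasure (Rd d × 𝒱) × ProbabilityMeasure (Rd d × 𝒱))} {a : ℝ}
    (ha : a ≤ 1) (h : ∀ q ∈ 𝒬, a ≤ xssPower h₁ h₂ α k uX uY (q.1 : Measure (Rd d × 𝒱)) q.2) :
    a ≤ worstCasePower h₁ h₂ α k uX uY 𝒬 := by
  refine le_csInf (Set.insert_nonempty _ _) ?_
  rintro b (rfl | ⟨q, hq, rfl⟩)
  · exact ha
  · exact h q hq

end Uniformity

/-! ### Bias and noise at the chosen bandwidth -/

section Rates

variable {d : ℕ} {β : ℝ} {s Δ : ℕ → ℝ}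

lemma rpow_rate_sq (n : ℕ) :
    ((n : ℝ) ^ (2 * β / (d + 4 * β))) ^ 2 = (n : ℝ) ^ (4 * β / (d + 4 * β)) := by
  rw [← Real.rpow_natCast, ← Real.rpow_mul (Nat.cast_nonneg n)]
  congr 1
  push_cast
  ring

/-- The squared bias of the smoothing is eventually negligible. -/
lemma eventually_bias_le (hβ : 0 < β) (hs_pos : ∀ n, 0 < s n)
    (hs : s =Θ[atTop] fun n : ℕ => (n : ℝ) ^ (4 / (d + 4 * β)))
    (hΔ : Tendsto (fun n : ℕ => Δ n * (n : ℝ) ^ (2 * β / (d + 4 * β))) atTop atTop) (M : ℝ) :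
    ∀ᶠ n in atTop, s n ^ (-β) * (4 * M) ≤ Δ n ^ 2 / 2 := by
  -- The bias needs `s` to be large enough, so only the lower half of the rate is used; the noise
  -- level uses the upper half.
  obtain ⟨c, hc, hcs⟩ := hs.2.exists_pos
  have hx : Tendsto (fun n : ℕ => (Δ n * (n : ℝ) ^ (2 * β / (d + 4 * β))) ^ 2) atTop atTop :=
    (tendsto_pow_atTop two_ne_zero).comp hΔ
  filter_upwards [hcs.bound, hx.eventually_ge_atTop (8 * |M| * c ^ β), eventually_ge_atTop 1]
    with n hn hxn hn1
  have hn0 : (0 : ℝ) < n := by exact_mod_cast hn1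
  have hpos : 0 < (n : ℝ) ^ (4 / (d + 4 * β)) := Real.rpow_pos_of_pos hn0 _
  rw [Real.norm_of_nonneg hpos.le, Real.norm_of_nonneg (hs_pos n).le] at hn
  have h1 : (n : ℝ) ^ (4 * β / (d + 4 * β)) ≤ c ^ β * s n ^ β := by
    rw [← Real.mul_rpow hc.le (hs_pos n).le]
    calc _ = ((n : ℝ) ^ (4 / (d + 4 * β))) ^ β := by
          rw [← Real.rpow_mul hn0.le]; congr 1; ring
      _ ≤ _ := Real.rpow_le_rpow hpos.le hn hβ.le
  rw [mul_pow, rpow_rate_sq n] at hxn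
  have hsβ : 0 < s n ^ β := Real.rpow_pos_of_pos (hs_pos n) _
  have hcβ : 0 < c ^ β := Real.rpow_pos_of_pos hc _
  have h2 : 8 * |M| * c ^ β ≤ Δ n ^ 2 * (s n ^ β) * c ^ β := by
    calc _ ≤ Δ n ^ 2 * (n : ℝ) ^ (4 * β / (d + 4 * β)) := hxn
      _ ≤ Δ n ^ 2 * (c ^ β * s n ^ β) := by gcongr
      _ = _ := by ring
  have h3 := le_of_mul_le_mul_right h2 hcβ
  rw [Real.rpow_neg (hs_pos n).le, inv_mul_le_iff₀ hsβ]
  have := le_abs_self M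
  linarith

/-- The noise level tends to zero. -/
lemma tendsto_noiseLevel (hβ : 0 < β) (hs_pos : ∀ n, 0 < s n)
    (hs : s =Θ[atTop] fun n : ℕ => (n : ℝ) ^ (4 / (d + 4 * β)))
    (hΔ : Tendsto (fun n : ℕ => Δ n * (n : ℝ) ^ (2 * β / (d + 4 * β))) atTop atTop) (M : ℝ) :
    Tendsto (fun n => √M / (n * √(kernelMass d (s n)) * Δ n ^ 2)) atTop (𝓝 0) := by
  obtain ⟨c, hc, hcs⟩ := hs.1.exists_pos
  have hx : Tendsto (fun n : ℕ => (Real.pi / c) ^ (d / 4 : ℝ) *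
      (Δ n * (n : ℝ) ^ (2 * β / (d + 4 * β))) ^ 2) atTop atTop :=
    ((tendsto_pow_atTop two_ne_zero).comp hΔ).const_mul_atTop
      (Real.rpow_pos_of_pos (by positivity) _)
  refine Tendsto.div_atTop tendsto_const_nhds (tendsto_atTop_mono' _ ?_ hx)
  filter_upwards [hcs.bound, eventually_ge_atTop 1] with n hn hn1
  have hn0 : (0 : ℝ) < n := by exact_mod_cast hn1
  have hpos : 0 < (n : ℝ) ^ (4 / (d + 4 * β)) := Real.rpow_pos_of_pos hn0 _
  rw [Real.norm_of_nonneg hpos.le, Real.norm_of_nonneg (hs_pos n).le] at hn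
  have hdβ : 0 < d + 4 * β := by positivity
  have hsqrt : √(kernelMass d (s n)) = (Real.pi / s n) ^ (d / 4 : ℝ) := by
    have := hs_pos n
    rw [kernelMass, Real.sqrt_eq_rpow, ← Real.rpow_mul (by positivity)]
    congr 1
    ring
  -- The exponents balance: `1 - d/(d + 4β) = 4β/(d + 4β)`, the square of the separation rate.
  have h1 : (Real.pi / c) ^ (d / 4 : ℝ) * (n : ℝ) ^ (4 * β / (d + 4 * β))
      ≤ n * √(kernelMass d (s n)) := by
    calc _ = n * (Real.pi / (c * (n : ℝ) ^ (4 / (d + 4 * β)))) ^ (d / 4 : ℝ) := by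
          rw [← div_div, Real.div_rpow (by positivity) hpos.le, ← Real.rpow_mul hn0.le]
          have : (n : ℝ) ^ (4 * β / (d + 4 * β))
              = n / (n : ℝ) ^ (4 / (d + 4 * β) * (d / 4)) := by
            rw [eq_div_iff (Real.rpow_pos_of_pos hn0 _).ne', ← Real.rpow_add hn0]
            conv_rhs => rw [← Real.rpow_one (n : ℝ)]
            congr 1
            field_simp
            ring
          rw [this]
          ring
      _ ≤ _ := by
          rw [hsqrt]
          have := hs_pos n
          gcongr
  rw [mul_pow, rpow_rate_sq n]
  calc _ = ((Real.pi / c) ^ (d / 4 : ℝ) * (n : ℝ) ^ (4 * β / (d + 4 * β))) * Δ n ^ 2 := by ring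
    _ ≤ _ := by gcongr

end Rates

end XssMMD

/-! ### The limit along even sample sizes -/

open XssMMD in
theorem mainTheorem7 {d : ℕ} (hd : 1 ≤ d) {𝒱 : Type*} [MeasurableSpace 𝒱]
    (α β M : ℝ) (hα : α ∈ Set.Ioo (0 : ℝ) 1) (hβ : 0 < β)
    (s Δ : ℕ → ℝ) (hs_pos : ∀ n, 0 < s n)
    (hs : s =Θ[atTop] fun n : ℕ => (n : ℝ) ^ (4 / (d + 4 * β)))
    (hΔ : Tendsto (fun n : ℕ => Δ n * (n : ℝ) ^ (2 * β / (d + 4 * β))) atTop atTop)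
    (h₁ h₂ : ℕ → ℕ)
    (uX uY : ∀ N : ℕ, Regressor d N 𝒱)
    (huX : ∀ N, MeasurableRegressor (gaussianKernel (s (2 * N))) (uX N))
    (huY : ∀ N, MeasurableRegressor (gaussianKernel (s (2 * N))) (uY N))
    (𝒬 : ℕ → Set (ProbabilityMeasure (Rd d × 𝒱) × ProbabilityMeasure (Rd d × 𝒱)))
    (h𝒬 : ∀ N, ∀ q ∈ 𝒬 N,
      ((q.1 : Measure (Rd d × 𝒱)).fst, (q.2 : Measure (Rd d × 𝒱)).fst)
        ∈ smoothAlternatives d β M (Δ (2 * N)))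
    (hres : ∃ C : ℝ≥0, ∀ N ≥ 1, ∀ q ∈ 𝒬 N,
      ResidualCondition (gaussianKernel (s (2 * N))) (uX N) (uY N) C
        (q.1 : Measure (Rd d × 𝒱)) (q.2 : Measure (Rd d × 𝒱))) :
    Tendsto
      (fun N : ℕ => worstCasePower (h₁ N) (h₂ N) α (gaussianKernel (s (2 * N)))
        (uX N) (uY N) (𝒬 N))
      atTop (𝓝 1) := by
  obtain ⟨C, hC⟩ := hres
  have h2 : Tendsto (fun N : ℕ => 2 * N) atTop atTop :=
    tendsto_id.const_mul_atTop' two_pos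
  set τ : ℕ → ℝ := fun N => noiseLevel d N (s (2 * N)) M (Δ (2 * N)) with hτdef
  have hτ : Tendsto τ atTop (𝓝 0) := by
    -- The rate is expressed in `n = 2 N`, the noise level in the fold size `N`, whence the factor
    -- `2`.
    have h := ((tendsto_noiseLevel hβ hs_pos hs hΔ M).comp h2).const_mul 2
    rw [mul_zero] at h
    refine h.congr fun N => ?_
    simp only [Function.comp_apply, hτdef, noiseLevel]
    push_cast
    rw [mul_assoc, mul_assoc, mul_assoc, ← mul_div_assoc, mul_div_mul_left _ _ two_ne_zero]
  have hlow : Tendsto (fun N => 1 - errorConst α C * (2 * τ N + 4 * τ N ^ 2)) atTop (𝓝 1) := by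
    have h := ((hτ.const_mul 2).add ((hτ.pow 2).const_mul 4)).const_mul (errorConst α C)
    simpa using h.const_sub 1
  -- No sign is imposed on the separation; divergence of the rescaled separation makes it eventually
  -- positive.
  have hΔpos : ∀ᶠ n in atTop, 0 < Δ n := by
    filter_upwards [hΔ.eventually_gt_atTop 0, eventually_ge_atTop 1] with n hn hn1
    have hn0 : (0 : ℝ) < n := by exact_mod_cast hn1
    exact pos_of_mul_pos_left hn (Real.rpow_pos_of_pos hn0 _).le
  refine tendsto_of_tendsto_of_tendsto_of_le_of_le' hlow tendsto_const_nhds ?_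
    (Eventually.of_forall fun N => worstCasePower_le_one _ _ _ _ _ _ _)
  filter_upwards [h2.eventually hΔpos, h2.eventually (eventually_bias_le hβ hs_pos hs hΔ M),
    eventually_ge_atTop 1] with N hN1 hN2 hN3
  refine le_worstCasePower ?_ fun q hq => one_sub_le_xssPower_of_smoothAlternatives
    (hs_pos _) hβ hN3 (huX N) (huY N) (hC N hN3 q hq) hN1 (h𝒬 N q hq) hN2
  have h0 : 0 ≤ τ N := noiseLevel_nonneg _ _ _ _ _
  have := mul_nonneg (errorConst_nonneg α C) (by positivity : 0 ≤ 2 * τ N + 4 * τ N ^ 2)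
  linarith
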